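/- Let $F$ be a field of characteristic $2$. A quasilinear quadratic form (below: a form) over $F$ is a map $q\colon V_q\to F$ on a finite-dimensional $F$-vector space with $q(v+w)=q(v)+q(w)$ and $q(\lambda v)=\lambda^2q(v)$; put $\dim(q)=\dim_F V_q$ and $D(q)=q(V_q)$. Its isotropic vectors ($q(v)=0$) form a subspace $U$; $\mathfrak{i}_0(q)=\dim_F U$ is the isotropy index, $q$ is anisotropic if $U=0$, and the anisotropic part $q_{an}$ is the form induced by $q$ on $V_q/U$. For a field extension $L/F$, $q_L$ is the scalar extension of $q$ to $V_q\otimes_F L$. A form $r$ is a subform of $q$ if $q\simeq r\perp r'$ for some form $r'$, and $q$ is divisible by a form $\pi$ if $q\simeq \pi\otimes r'$ for some form $r'$. For $s\ge 0$, an $s$-fold quasi-Pfister form is a form $\langle 1,-a_1\rangle\otimes\cdots\otimes\langle 1,-a_s\rangle$ with $a_i\in F^*$ (for $s=0$: $\langle 1\rangle$); it has dimension $2^s$. The divisibility index $\mathfrak{d}_0(q)$ is the largest $s\geq 0$ such that $q_{an}$ is divisible by an $s$-fold quasi-Pfister form (and $\infty$ if $q_{an}$ has dimension $0$). For a non-zero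 form $q$, $\mathrm{lndeg}(q)=\log_2[N(q):F^2]$, where $F^2$ is the field of squares in $F$ and $N(q)$ is the smallest subfield of $F$ containing all ratios of non-zero elements of $D(q)$. For an anisotropic form $p$ of dimension $\geq 2$, $F(p)$ denotes the function field of the (integral) projective quadric $\{p=0\}$, $p_1=(p_{F(p)})_{an}$, and $\mathfrak{d}_1(p)=\mathfrak{d}_0(p_1)$. **Proposition 6.12.** Let $p$ and $q$ be anisotropic quasilinear quadratic forms of dimension $\geq 2$ over $F$, and let $\epsilon$ be the unique integer in $[1,2^{\mathfrak{d}_1(p)}]$ such that $\mathfrak{i}_0(q_{F(p)})+\epsilon\equiv 0 \pmod{2^{\mathfrak{d}_1(p)}}$. If $$\dim(q)-2\,\mathfrak{i}_0(q_{F(p)})<\epsilon,$$ then there exist a purely transcendental field extension $L$ of $F$ (possibly $L=F$) and a subform $r$ of $(q_{L(p)})_{an}$, where $L(p)=L(p_L)$, such that 1. $\dim(r)=\mathfrak{i}_0(q_{F(p)})$; 2. $\mathfrak{d}_0(r)\geq \mathrm{lndeg}(p)-1$, i.e. $r$ is divisible by a quasi-Pfister form of dimension $2^{\mathrm{lndeg}(p)-1}$.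 -/

import Mathlib

open scoped TensorProduct

universe u v w

/-- A quasilinear quadratic form on the vector space `V` over the field `F` of characteristic `2`:
a map `q : V → F` with `q (v + w) = q v + q w` and `q (a • v) = a ^ 2 * q v`.  In other words, an
additive map that is semilinear with respect to the Frobenius endomorphism `a ↦ a ^ 2`. -/
abbrev QuasilinearForm (F V : Type*) [Field F] [CharP F 2] [AddCommGroup V] [Module F V] :=
  V →ₛₗ[frobenius F 2] F

namespace QuasilinearForm

section Basic

variable {F : Type*} [Field F] [CharP F 2]
variable {V : Type*} [AddCommGroup V] [Module F V]
variable {W : Type*} [AddCommGroup W] [Module F W]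

theorem apply_smul (q : QuasilinearForm F V) (a : F) (v : V) : q (a • v) = a ^ 2 * q v := by
  rw [map_smulₛₗ, frobenius_def, smul_eq_mul]

/-- Quasilinear forms are the same thing as additive quadratic forms in the sense of Mathlib. -/
def equivQuadraticForm :
    QuasilinearForm F V ≃ {q : QuadraticForm F V // ∀ v w, q (v + w) = q v + q w} where
  toFun q := ⟨{ toFun := fun v => q v
                toFun_smul := fun a v => by rw [apply_smul, smul_eq_mul, sq]
                exists_companion' := ⟨0, fun v w => by simp⟩ }, fun v w => map_add q v w⟩
  invFun q :=
    { toFun := fun v => q.1 v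
      map_add' := q.2
      map_smul' := fun a v => by
        rw [QuadraticMap.map_smul, frobenius_def, smul_eq_mul, smul_eq_mul, sq] }
  left_inv _ := rfl
  right_inv _ := rfl

/-- The dimension of a form: the dimension of the space on which it is defined. -/
noncomputable def dim (_q : QuasilinearForm F V) : ℕ := Module.finrank F V

/-- The set `D(q)` of all elements of `F` represented by `q`. -/
def values (q : QuasilinearForm F V) : Set F := Set.range q

/-- A form is anisotropic if it has no non-zero isotropic vector. -/
def Anisotropic (q : QuasilinearForm F V) : Prop := ∀ v, q v = 0 → v = 0

/-- Isometry of forms. -/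
def Isometric (p : QuasilinearForm F V) (q : QuasilinearForm F W) : Prop :=
  ∃ e : V ≃ₗ[F] W, ∀ v, q (e v) = p v

/-- The orthogonal sum `p ⊥ q`. -/
def orthogonalSum (p : QuasilinearForm F V) (q : QuasilinearForm F W) :
    QuasilinearForm F (V × W) where
  toFun x := p x.1 + q x.2
  map_add' x y := by simp only [Prod.fst_add, Prod.snd_add, map_add]; ring
  map_smul' a x := by
    simp only [Prod.smul_fst, Prod.smul_snd, map_smulₛₗ, smul_eq_mul]; ring

/-- The diagonal form `⟨a 0, …, a (n - 1)⟩ : x ↦ ∑ a i * x i ^ 2`. -/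
def diagonal {n : ℕ} (a : Fin n → F) : QuasilinearForm F (Fin n → F) where
  toFun x := ∑ i, a i * x i ^ 2
  map_add' x y := by
    rw [← Finset.sum_add_distrib]
    refine Finset.sum_congr rfl fun i _ => ?_
    rw [Pi.add_apply, CharTwo.add_sq, mul_add]
  map_smul' c x := by
    rw [frobenius_def, smul_eq_mul, Finset.mul_sum]
    refine Finset.sum_congr rfl fun i _ => ?_
    rw [Pi.smul_apply, smul_eq_mul]; ring

/-- `p` is a subform of `q` if `q ≃ p ⊥ r` for some form `r`; up to isometry, the
(finite-dimensional) form `r` may be taken on a coordinate space. -/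
def IsSubform (p : QuasilinearForm F V) (q : QuasilinearForm F W) : Prop :=
  ∃ (n : ℕ) (r : QuasilinearForm F (Fin n → F)), Isometric q (orthogonalSum p r)

/-- The tensor product `p ⊗ q`, characterized by `v ⊗ w ↦ p v * q w`. -/
noncomputable def tensor (p : QuasilinearForm F V) (q : QuasilinearForm F W) :
    QuasilinearForm F (V ⊗[F] W) :=
  TensorProduct.lift (LinearMap.mk₂'ₛₗ (frobenius F 2) (frobenius F 2) (fun v w => p v * q w)
    (fun v v' w => by rw [map_add, add_mul])
    (fun a v w => by rw [map_smulₛₗ, smul_eq_mul, smul_eq_mul, mul_assoc])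
    (fun v w w' => by rw [map_add, mul_add])
    (fun a v w => by rw [map_smulₛₗ, smul_eq_mul, smul_eq_mul, mul_left_comm]))

theorem tensor_tmul (p : QuasilinearForm F V) (q : QuasilinearForm F W) (v : V) (w : W) :
    tensor p q (v ⊗ₜ w) = p v * q w := rfl

/-- `q` is divisible by `p` if `q ≃ p ⊗ r` for some form `r`; up to isometry, the
(finite-dimensional) form `r` may be taken on a coordinate space. -/
def IsDivisibleBy (q : QuasilinearForm F V) (p : QuasilinearForm F W) : Prop :=
  ∃ (n : ℕ) (r : QuasilinearForm F (Fin n → F)), Isometric q (tensor p r)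

/-- `IsQuasiPfister n π`: the form `π` is, up to isometry, an `n`-fold quasi-Pfister form
`⟨1, -a₁⟩ ⊗ ⋯ ⊗ ⟨1, -aₙ⟩` with `aᵢ ≠ 0`.  The `0`-fold quasi-Pfister form is `⟨1⟩`. -/
def IsQuasiPfister : (n : ℕ) → {m : ℕ} → QuasilinearForm F (Fin m → F) → Prop
  | 0, _, π => Isometric π (diagonal ![(1 : F)])
  | n + 1, _, π => ∃ a : F, a ≠ 0 ∧ ∃ (m : ℕ) (ρ : QuasilinearForm F (Fin m → F)),
      IsQuasiPfister n ρ ∧ Isometric π (tensor (diagonal ![1, -a]) ρ)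

/-- The form `q` is divisible by some `n`-fold quasi-Pfister form. -/
def IsDivisibleByQuasiPfister (n : ℕ) (q : QuasilinearForm F V) : Prop :=
  ∃ (m : ℕ) (π : QuasilinearForm F (Fin m → F)), IsQuasiPfister n π ∧ IsDivisibleBy q π

/-- The isotropy index `𝔦₀(q)`.  The isotropic vectors of a quasilinear form make up the subspace
`ker q`, which is therefore the largest totally isotropic subspace. -/
noncomputable def isotropyIndex (q : QuasilinearForm F V) : ℕ :=
  Module.finrank F (LinearMap.ker q)

/-- The isotropy index is the maximal dimension of a totally isotropic subspace. -/
theorem isGreatest_isotropyIndex [FiniteDimensional F V] (q : QuasilinearForm F V) :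
    IsGreatest {n | ∃ U : Submodule F V, (∀ u ∈ U, q u = 0) ∧ Module.finrank F U = n}
      (isotropyIndex q) := by
  refine ⟨⟨LinearMap.ker q, fun u hu => hu, rfl⟩, ?_⟩
  rintro n ⟨U, hU, rfl⟩
  exact Submodule.finrank_mono (fun u hu => hU u hu)

/-- The anisotropic part of `q`: the form induced by `q` on the quotient of `V` by the subspace of
isotropic vectors. -/
def anisotropicPart (q : QuasilinearForm F V) : QuasilinearForm F (V ⧸ LinearMap.ker q) :=
  (LinearMap.ker q).liftQ q le_rfl

theorem anisotropicPart_mk (q : QuasilinearForm F V) (v : V) :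
    anisotropicPart q (Submodule.Quotient.mk v) = q v := rfl

/-- The divisibility index `𝔡₀(q)`: the largest `s` such that the anisotropic part of `q` is
divisible by an `s`-fold quasi-Pfister form.  It is `⊤` if the anisotropic part of `q` is zero. -/
noncomputable def divisibilityIndex (q : QuasilinearForm F V) : ℕ∞ :=
  ⨆ s ∈ {s : ℕ | IsDivisibleByQuasiPfister s (anisotropicPart q)}, (s : ℕ∞)

/-- The norm field `N(q)`: the smallest subfield of `F` containing all ratios of non-zero values
of `q`. -/
def normField (q : QuasilinearForm F V) : Subfield F :=
  Subfield.closure {c | ∃ a ∈ values q, ∃ b ∈ values q, a ≠ 0 ∧ b ≠ 0 ∧ c = a / b}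

/-- `lndeg(q) = log₂ [N(q) : F²]`, for a non-zero form `q` on a finite-dimensional space (for such
a form `F² ⊆ N(q)` and the degree `[N(q) : F²]` is a power of `2`). -/
noncomputable def lndeg (q : QuasilinearForm F V) : ℕ :=
  Nat.log 2 (Subfield.relfinrank (frobenius F 2).fieldRange (normField q))

end Basic

section BaseChange

variable {F : Type*} [Field F] [CharP F 2] {V : Type*} [AddCommGroup V] [Module F V]

/-- The scalar extension `q_L` of `q`, characterized by `x ⊗ v ↦ x ^ 2 * q v`. -/
noncomputable def baseChange (L : Type*) [Field L] [CharP L 2] [Algebra F L]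
    (q : QuasilinearForm F V) : QuasilinearForm L (L ⊗[F] V) where
  toFun := TensorProduct.liftAddHom (R := F)
    (AddMonoidHom.mk' (fun x : L =>
        AddMonoidHom.mk' (fun v : V => x ^ 2 * algebraMap F L (q v)) fun v w => by
          rw [map_add, map_add, mul_add]) fun x y => by
      ext v
      change (x + y) ^ 2 * _ = x ^ 2 * _ + y ^ 2 * _
      rw [CharTwo.add_sq, add_mul])
    fun a x v => by
      change (a • x) ^ 2 * _ = x ^ 2 * algebraMap F L (q (a • v))
      rw [apply_smul, Algebra.smul_def, map_mul, map_pow]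
      ring
  map_add' := map_add _
  map_smul' a z := by
    induction z with
    | zero => simp
    | add z z' h h' => rw [smul_add, map_add, h, h', map_add, smul_add]
    | tmul x v =>
      change (a * x) ^ 2 * algebraMap F L (q v) = a ^ 2 * (x ^ 2 * algebraMap F L (q v))
      ring

theorem baseChange_tmul (L : Type*) [Field L] [CharP L 2] [Algebra F L]
    (q : QuasilinearForm F V) (x : L) (v : V) :
    baseChange L q (x ⊗ₜ v) = x ^ 2 * algebraMap F L (q v) := rfl

end BaseChange

section FunctionField

variable {F : Type*} [Field F] [CharP F 2] {V : Type*} [AddCommGroup V] [Module F V]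

/-- The form `q` as a homogeneous polynomial `∑ q(eᵢ) Tᵢ²` in the coordinates `Tᵢ` with respect to
a basis `(eᵢ)` of `V`. -/
noncomputable def polynomial [FiniteDimensional F V] (q : QuasilinearForm F V) :
    MvPolynomial (Fin (Module.finrank F V)) F :=
  ∑ i, MvPolynomial.C (q (Module.finBasis F V i)) * MvPolynomial.X i ^ 2

/-- If `q` is anisotropic of dimension at least `2`, its polynomial is irreducible. -/
theorem irreducible_polynomial [FiniteDimensional F V] (q : QuasilinearForm F V)
    (hq : Anisotropic q) (h2 : 2 ≤ dim q) : Irreducible (polynomial q) := by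
  set b := Module.finBasis F V
  have hev : ∀ v, MvPolynomial.eval v (polynomial q) = q (∑ i, v i • b i) := by
    intro v
    simp only [polynomial, map_sum, map_mul, map_pow, MvPolynomial.eval_C, MvPolynomial.eval_X,
      apply_smul]
    exact Finset.sum_congr rfl fun i _ => mul_comm _ _
  have hne : ∀ v, MvPolynomial.eval v (polynomial q) = 0 → v = 0 := by
    intro v hv
    have h0 := hq _ ((hev v).symm.trans hv)
    funext i
    exact Fintype.linearIndependent_iff.1 b.linearIndependent v h0 i
  have hhom : (polynomial q).IsHomogeneous 2 :=
    MvPolynomial.IsHomogeneous.sum _ _ _ fun i _ => MvPolynomial.isHomogeneous_C_mul_X_pow _ _ _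
  have hlin : ∀ f : MvPolynomial (Fin (Module.finrank F V)) F, f.IsHomogeneous 1 →
      ∃ l : (Fin (Module.finrank F V) → F) →ₗ[F] F, ∀ v, MvPolynomial.eval v f = l v := by
    intro f hf
    rw [← MvPolynomial.mem_homogeneousSubmodule,
      MvPolynomial.homogeneousSubmodule_one_eq_span_X] at hf
    induction hf using Submodule.span_induction with
    | mem x hx =>
      obtain ⟨i, rfl⟩ := hx
      exact ⟨LinearMap.proj i, fun v => by simp⟩
    | zero => exact ⟨0, fun v => by simp⟩
    | add x y _ _ hx hy =>
      obtain ⟨l, hl⟩ := hx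
      obtain ⟨m, hm⟩ := hy
      exact ⟨l + m, fun v => by simp [hl, hm]⟩
    | smul a x _ hx =>
      obtain ⟨l, hl⟩ := hx
      exact ⟨a • l, fun v => by simp [hl, MvPolynomial.smul_eval]⟩
  have hvec : ∀ l : (Fin (Module.finrank F V) → F) →ₗ[F] F, ∃ v, v ≠ 0 ∧ l v = 0 := by
    intro l
    have h2' : 2 ≤ Module.finrank F V := h2
    obtain ⟨v, hv, hv0⟩ := (Submodule.ne_bot_iff _).1
      (LinearMap.ker_ne_bot_of_finrank_lt (f := l) (by simp; omega))
    exact ⟨v, hv0, hv⟩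
  have hP0 : polynomial q ≠ 0 := by
    intro h0
    obtain ⟨v, hv, -⟩ := hvec 0
    exact hv (hne v (by rw [h0, map_zero]))
  have hdeg : (polynomial q).totalDegree = 2 := hhom.totalDegree hP0
  have hunit : ∀ f : MvPolynomial (Fin (Module.finrank F V)) F, f ≠ 0 → f.totalDegree = 0 →
      IsUnit f := by
    intro f hf hf0
    rw [MvPolynomial.totalDegree_eq_zero_iff_eq_C] at hf0
    rw [hf0] at hf ⊢
    exact (isUnit_iff_ne_zero.2 fun h => hf (by rw [h, map_zero])).map MvPolynomial.C
  have hsplit : ∀ f : MvPolynomial (Fin (Module.finrank F V)) F, f.totalDegree = 1 →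
      f = MvPolynomial.homogeneousComponent 0 f + MvPolynomial.homogeneousComponent 1 f := by
    intro f hf
    conv_lhs => rw [← MvPolynomial.sum_homogeneousComponent f, hf]
    simp [Finset.sum_range_succ]
  refine ⟨fun hu => ?_, fun f g hfg => ?_⟩
  · rw [MvPolynomial.isUnit_iff_totalDegree_of_isReduced] at hu
    omega
  · have hf : f ≠ 0 := by rintro rfl; exact hP0 (by rw [hfg, zero_mul])
    have hg : g ≠ 0 := by rintro rfl; exact hP0 (by rw [hfg, mul_zero])
    have hd : f.totalDegree + g.totalDegree = 2 := by
      rw [← MvPolynomial.totalDegree_mul_of_isDomain hf hg, ← hfg, hdeg]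
    by_contra hcon
    rw [not_or] at hcon
    have hf1 : f.totalDegree ≠ 0 := fun h => hcon.1 (hunit f hf h)
    have hg1 : g.totalDegree ≠ 0 := fun h => hcon.2 (hunit g hg h)
    have hfs := hsplit f (by omega)
    have hgs := hsplit g (by omega)
    have f0 := MvPolynomial.homogeneousComponent_isHomogeneous 0 f
    have f1 := MvPolynomial.homogeneousComponent_isHomogeneous 1 f
    have g0 := MvPolynomial.homogeneousComponent_isHomogeneous 0 g
    have g1 := MvPolynomial.homogeneousComponent_isHomogeneous 1 g
    have key : polynomial q = MvPolynomial.homogeneousComponent 1 f *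
        MvPolynomial.homogeneousComponent 1 g := by
      have h := congrArg (MvPolynomial.homogeneousComponent 2) hfg
      rw [MvPolynomial.homogeneousComponent_eq_self hhom, hfs, hgs] at h
      rw [h, add_mul, mul_add, mul_add, map_add, map_add, map_add,
        MvPolynomial.homogeneousComponent_of_mem (f0.mul g0),
        MvPolynomial.homogeneousComponent_of_mem (f0.mul g1),
        MvPolynomial.homogeneousComponent_of_mem (f1.mul g0),
        MvPolynomial.homogeneousComponent_of_mem (f1.mul g1)]
      simp
    obtain ⟨l, hl⟩ := hlin _ f1
    obtain ⟨v, hv, hlv⟩ := hvec l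
    exact hv (hne v (by rw [key, map_mul, hl, hlv, zero_mul]))

open Classical in
/-- The ideal of the affine cone `{q = 0}`.  The ideal generated by the polynomial of `q` is prime
when `q` is anisotropic of dimension at least `2`; see `coneIdeal_eq`.  When it is not prime, the
function field of `q` is not considered, and the value is irrelevant. -/
noncomputable def coneIdeal [FiniteDimensional F V] (q : QuasilinearForm F V) :
    Ideal (MvPolynomial (Fin (Module.finrank F V)) F) :=
  if (Ideal.span {polynomial q}).IsPrime then Ideal.span {polynomial q} else ⊥

instance coneIdeal_isPrime [FiniteDimensional F V] (q : QuasilinearForm F V) :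
    (coneIdeal q).IsPrime := by
  unfold coneIdeal
  split_ifs with h
  · exact h
  · exact Ideal.isPrime_bot

/-- If `q` is anisotropic of dimension at least `2`, the ideal of its affine cone is generated by
the polynomial of `q`. -/
theorem coneIdeal_eq [FiniteDimensional F V] (q : QuasilinearForm F V)
    (hq : Anisotropic q) (h2 : 2 ≤ dim q) : coneIdeal q = Ideal.span {polynomial q} :=
  have h := irreducible_polynomial q hq h2
  if_pos ((Ideal.span_singleton_prime h.ne_zero).2 h.prime)

/-- The function field `F[q]` of the affine cone `{q = 0}`, i.e. the field of fractions of
`F[T₁, …, Tₙ] / (q(T))`. -/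
abbrev AffineFunctionField [FiniteDimensional F V] (q : QuasilinearForm F V) :=
  FractionRing (MvPolynomial (Fin (Module.finrank F V)) F ⧸ coneIdeal q)

/-- The homogeneous coordinate `Tᵢ` as an element of `F[q]`. -/
noncomputable def coordinate [FiniteDimensional F V] (q : QuasilinearForm F V)
    (i : Fin (Module.finrank F V)) : AffineFunctionField q :=
  algebraMap (MvPolynomial (Fin (Module.finrank F V)) F ⧸ coneIdeal q) (AffineFunctionField q)
    (Ideal.Quotient.mk (coneIdeal q) (MvPolynomial.X i))

/-- The function field `F(q)` of the projective quadric `{q = 0}`, as a subfield of `F[q]`: it is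
generated over `F` by the quotients `Tᵢ / Tⱼ` of homogeneous coordinates. -/
noncomputable def functionSubfield [FiniteDimensional F V] (q : QuasilinearForm F V) :
    IntermediateField F (AffineFunctionField q) :=
  IntermediateField.adjoin F {z | ∃ i j, z = coordinate q i / coordinate q j}

/-- The function field `F(q)` of the projective quadric `{q = 0}`. -/
def FunctionField [FiniteDimensional F V] (q : QuasilinearForm F V) : Type _ :=
  functionSubfield q

noncomputable instance [FiniteDimensional F V] (q : QuasilinearForm F V) :
    Field (FunctionField q) :=
  inferInstanceAs (Field (functionSubfield q))

noncomputable instance [FiniteDimensional F V] (q : QuasilinearForm F V) :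
    Algebra F (FunctionField q) :=
  inferInstanceAs (Algebra F (functionSubfield q))

instance [FiniteDimensional F V] (q : QuasilinearForm F V) : CharP (FunctionField q) 2 :=
  charP_of_injective_algebraMap (algebraMap F (FunctionField q)).injective 2

/-- The form `p₁ = (p_{F(p)})_an`, the first higher anisotropic kernel of `p`, for an anisotropic
form `p` of dimension at least `2`. -/
noncomputable def firstKernel [FiniteDimensional F V] (p : QuasilinearForm F V) :
    QuasilinearForm (FunctionField p)
      ((FunctionField p ⊗[F] V) ⧸ LinearMap.ker (baseChange (FunctionField p) p)) :=
  anisotropicPart (baseChange (FunctionField p) p)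

/-- The first higher divisibility index `𝔡₁(p) = 𝔡₀(p₁)`, for an anisotropic form `p` of dimension
at least `2` (it is finite, since `p₁` is not zero). -/
noncomputable def firstDivisibilityIndex [FiniteDimensional F V] (p : QuasilinearForm F V) : ℕ :=
  (divisibilityIndex (firstKernel p)).toNat

end FunctionField

end QuasilinearForm

/-- A field extension `L / F` is purely transcendental if `L` is generated over `F` by a set of
algebraically independent elements. -/
def IsPurelyTranscendental (F L : Type*) [Field F] [Field L] [Algebra F L] : Prop :=
  ∃ s : Set L, AlgebraicIndependent F ((↑) : s → L) ∧ IntermediateField.adjoin F s = ⊤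

/-! A quasilinear form $q$ is the same as an $F$-linear map $\sqrt q : V \to F^{1/2}$. Its kernel is
the space of isotropic vectors, and an anisotropic form is determined up to isometry by the
finite-dimensional subspace of $F^{1/2}$ that is its image. In these terms subforms are subspaces,
tensor products give products of subspaces, quasi-Pfister forms give subfields, and divisibility by
a quasi-Pfister form is stability under a subfield.

Let $E = F(p)$, and let $D$ and $B$ be the subspaces of $E^{1/2}$ attached to $q_E$ and $p_E$. Write
$E = K(y)$ with $K = F(x_i)$ purely transcendental and $y^2 \in K$. Applying $\partial/\partial y$
to the coordinates of isotropic vectors of $q_E$ is $E$-linear and injective, because $q$ stays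
anisotropic over $K$. Over $F^{1/2}$ the equation of $p$ becomes linear, so $y$ is a linear form in
the $x_i$; differentiating the isotropy relation in each $x_i$ then shows that, after rescaling, the
image $U$ satisfies $BU \subseteq D$ (`exists_submodule_mul_mem`). Here $\dim U =
\mathfrak{i}_0(q_E)$ and $\dim D = \dim q - \mathfrak{i}_0(q_E)$.

Now $BU$ is stable under a field of degree $2^{\mathfrak{d}_1(p)}$ over $E$, so this number divides
$\dim BU$. As $\mathfrak{i}_0 \le \dim BU < \mathfrak{i}_0 + \epsilon$, the congruence forces $\dim
BU = \mathfrak{i}_0$. Hence $\sqrt{p(v)}\,U = BU$ for all $v \neq 0$, and $BU$ is stable under all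
ratios $\sqrt{p(v)/p(w)}$, that is, under $N(p)^{1/2}$ (`exists_stable_submodule`). The inclusion
$BU \subseteq D$, applied to a form with values $N(p)$, shows that at least half of the degree of
$N(p)$ survives over $E$ (`exists_submodule_of_normField`). So the form attached to $BU$ is the
desired $r$, and $L = F$ suffices. -/

/-! ### Subspaces and subfields of $F^{1/2}$. -/

/-- The field `F`, regarded as the extension `F^{1/2}` of `F`: the structure map is the Frobenius
endomorphism. -/
def SqrtExt (F : Type*) : Type _ := F

namespace SqrtExt

variable {F : Type*} [Field F]

instance : Field (SqrtExt F) := inferInstanceAs (Field F)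

instance [CharP F 2] : CharP (SqrtExt F) 2 := inferInstanceAs (CharP F 2)

/-- The formal square root `F → F^{1/2}`. -/
def root : F ≃+* SqrtExt F := RingEquiv.refl F

noncomputable instance [CharP F 2] : Algebra F (SqrtExt F) :=
  ((root (F := F)).toRingHom.comp (frobenius F 2)).toAlgebra

variable [CharP F 2]

theorem algebraMap_apply (a : F) : algebraMap F (SqrtExt F) a = root (a ^ 2) := rfl

theorem root_mul_self (a : F) : root a * root a = algebraMap F (SqrtExt F) a := by
  rw [algebraMap_apply, sq, map_mul]

theorem mul_self (x : SqrtExt F) : x * x = algebraMap F (SqrtExt F) (root.symm x) := by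
  rw [← root_mul_self, RingEquiv.apply_symm_apply]

/-- The square of $x$ lies in $F$. Consequently any subalgebra of $F^{1/2}$ is closed under
inverses. -/
theorem inv_eq_smul (x : SqrtExt F) : x⁻¹ = (root.symm x)⁻¹ • x := by
  rw [Algebra.smul_def, map_inv₀, ← mul_self]
  by_cases hx : x = 0
  · simp [hx]
  · field_simp

theorem root_sq_mul (a b : F) : root (a ^ 2 * b) = a • root b := by
  rw [Algebra.smul_def, algebraMap_apply, map_mul]

variable {E : Type*} [Field E] [CharP E 2] [Algebra F E]

variable (F E) in
/-- The embedding `F^{1/2} → E^{1/2}` induced by a field extension `E / F`. -/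
def map : SqrtExt F →+* SqrtExt E :=
  (root (F := E)).toRingHom.comp ((algebraMap F E).comp (root (F := F)).symm.toRingHom)

omit [CharP F 2] [CharP E 2] in
theorem map_root (a : F) : map F E (root a) = root (algebraMap F E a) := rfl

theorem map_algebraMap (a : F) :
    map F E (algebraMap F (SqrtExt F) a) = algebraMap E (SqrtExt E) (algebraMap F E a) := by
  rw [algebraMap_apply, map_root, algebraMap_apply, map_pow]

theorem map_smul_eq (a : F) (z : SqrtExt F) : map F E (a • z) = algebraMap F E a • map F E z := by
  rw [Algebra.smul_def, map_mul, map_algebraMap, Algebra.smul_def]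

/-- A subalgebra of `F^{1/2}` is a field. -/
noncomputable def toIntermediateField (S : Subalgebra F (SqrtExt F)) :
    IntermediateField F (SqrtExt F) :=
  S.toIntermediateField fun x hx => by
    rw [inv_eq_smul]
    exact S.smul_mem hx _

/-- The stabilizer of a subspace of `F^{1/2}`. -/
noncomputable def stabilizer (R : Submodule F (SqrtExt F)) : IntermediateField F (SqrtExt F) :=
  toIntermediateField
    { carrier := {t | ∀ r ∈ R, t * r ∈ R}
      mul_mem' := fun {a b} ha hb r hr => by rw [mul_assoc]; exact ha _ (hb _ hr)
      add_mem' := fun {a b} ha hb r hr => by rw [add_mul]; exact R.add_mem (ha _ hr) (hb _ hr)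
      algebraMap_mem' := fun a r hr => by rw [← Algebra.smul_def]; exact R.smul_mem _ hr }

theorem mem_stabilizer {R : Submodule F (SqrtExt F)} {t : SqrtExt F} :
    t ∈ stabilizer R ↔ ∀ r ∈ R, t * r ∈ R := Iff.rfl

/-- A subspace stable under multiplication by an intermediate field `P`, as a `P`-subspace. -/
noncomputable def extendSubmodule (P : IntermediateField F (SqrtExt F))
    (R : Submodule F (SqrtExt F)) (h : ∀ t ∈ P, ∀ r ∈ R, t * r ∈ R) :
    Submodule P (SqrtExt F) where
  carrier := R
  add_mem' := R.add_mem
  zero_mem' := R.zero_mem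
  smul_mem' := fun t r hr => h t t.2 r hr

theorem finrank_mul_finrank_extendSubmodule (P : IntermediateField F (SqrtExt F))
    (R : Submodule F (SqrtExt F)) (h : ∀ t ∈ P, ∀ r ∈ R, t * r ∈ R) :
    Module.finrank F P * Module.finrank P (extendSubmodule P R h) = Module.finrank F R :=
  Module.finrank_mul_finrank F P (extendSubmodule P R h)

/-- A $P$-basis of $R$ provides the second factor when the form attached to $R$ is to be written as
a tensor product; the dimension formula ensures that this product is anisotropic. -/
theorem exists_basis_of_stable (P : IntermediateField F (SqrtExt F))
    (R : Submodule F (SqrtExt F)) [FiniteDimensional F R] (h : ∀ t ∈ P, ∀ r ∈ R, t * r ∈ R) :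
    ∃ (l : ℕ) (y : Fin l → SqrtExt F), Module.finrank F R = Module.finrank F P * l ∧
      Subalgebra.toSubmodule P.toSubalgebra * Submodule.span F (Set.range y) = R := by
  have : FiniteDimensional F (extendSubmodule P R h) := ‹FiniteDimensional F R›
  have : FiniteDimensional P (extendSubmodule P R h) :=
    Module.Finite.of_restrictScalars_finite F P _
  have : Module.Free P (extendSubmodule P R h) := Module.Free.of_divisionRing P _
  let b := Module.finBasis P (extendSubmodule P R h)
  refine ⟨_, fun i => (b i : SqrtExt F), (finrank_mul_finrank_extendSubmodule P R h).symm,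
    le_antisymm ?_ ?_⟩
  · rw [Submodule.mul_le]
    intro t ht r hr
    refine h t ht r ?_
    refine (Submodule.span_le.2 ?_) hr
    rintro _ ⟨i, rfl⟩
    exact (b i).2
  · intro r hr
    have h1 := b.sum_repr ⟨r, hr⟩
    have h2 := congrArg Subtype.val h1
    simp only [Submodule.coe_sum, Submodule.coe_smul] at h2
    rw [← h2]
    refine Submodule.sum_mem _ fun i _ => ?_
    exact Submodule.mul_mem_mul (b.repr ⟨r, hr⟩ i).2 (Submodule.subset_span ⟨i, rfl⟩)

end SqrtExt

namespace QuasilinearForm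

open SqrtExt

/-! ### Forms as linear maps into $F^{1/2}$. -/

section SqrtMap

variable {F : Type*} [Field F] [CharP F 2]
variable {V : Type*} [AddCommGroup V] [Module F V]
variable {W : Type*} [AddCommGroup W] [Module F W]

/-- A quasilinear form `q` as the `F`-linear map `√q : V → F^{1/2}`. -/
def sqrtMap (q : QuasilinearForm F V) : V →ₗ[F] SqrtExt F where
  toFun v := root (q v)
  map_add' v w := by rw [map_add, map_add]
  map_smul' a v := by rw [apply_smul, root_sq_mul, RingHom.id_apply]

theorem sqrtMap_apply (q : QuasilinearForm F V) (v : V) : sqrtMap q v = root (q v) := rfl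

/-- The quasilinear form attached to an `F`-linear map `V → F^{1/2}`. -/
noncomputable def ofLinearMap (f : V →ₗ[F] SqrtExt F) : QuasilinearForm F V where
  toFun v := root.symm (f v)
  map_add' v w := by rw [map_add, map_add]
  map_smul' a v := by
    rw [LinearMap.map_smul, Algebra.smul_def, map_mul, SqrtExt.algebraMap_apply, RingEquiv.symm_apply_apply,
      frobenius_def, smul_eq_mul]

theorem sqrtMap_ofLinearMap (f : V →ₗ[F] SqrtExt F) : sqrtMap (ofLinearMap f) = f := rfl

theorem ker_sqrtMap (q : QuasilinearForm F V) : LinearMap.ker (sqrtMap q) = LinearMap.ker q := by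
  ext v
  rw [LinearMap.mem_ker, LinearMap.mem_ker, sqrtMap_apply, map_eq_zero_iff _ root.injective]

theorem sqrtMap_injective_iff (q : QuasilinearForm F V) :
    Function.Injective (sqrtMap q) ↔ Anisotropic q := by
  rw [← LinearMap.ker_eq_bot, ker_sqrtMap, LinearMap.ker_eq_bot']
  rfl

/-- Dividing out the kernel does not change the image, so anisotropic parts can be handled through
the range of `sqrtMap q` alone. -/
theorem range_anisotropicPart (q : QuasilinearForm F V) :
    LinearMap.range (sqrtMap (anisotropicPart q)) = LinearMap.range (sqrtMap q) := by
  ext z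
  constructor
  · rintro ⟨v, rfl⟩
    obtain ⟨v, rfl⟩ := Submodule.Quotient.mk_surjective _ v
    exact ⟨v, rfl⟩
  · rintro ⟨v, rfl⟩
    exact ⟨Submodule.Quotient.mk v, rfl⟩

theorem anisotropic_anisotropicPart (q : QuasilinearForm F V) :
    Anisotropic (anisotropicPart q) := by
  intro v hv
  obtain ⟨v, rfl⟩ := Submodule.Quotient.mk_surjective _ v
  exact (Submodule.Quotient.mk_eq_zero _).2 hv

theorem isotropyIndex_add_finrank_range [FiniteDimensional F V] (q : QuasilinearForm F V) :
    isotropyIndex q + Module.finrank F (LinearMap.range (sqrtMap q)) = dim q := by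
  rw [isotropyIndex, ← ker_sqrtMap, add_comm]
  exact LinearMap.finrank_range_add_finrank_ker (sqrtMap q)

/-- Anisotropic forms with the same values are isometric. -/
theorem isometric_of_range_eq {p : QuasilinearForm F V} {q : QuasilinearForm F W}
    (hp : Function.Injective (sqrtMap p)) (hq : Function.Injective (sqrtMap q))
    (h : LinearMap.range (sqrtMap p) = LinearMap.range (sqrtMap q)) : Isometric p q := by
  let e := (LinearEquiv.ofInjective (sqrtMap p) hp).trans
    ((LinearEquiv.ofEq _ _ h).trans (LinearEquiv.ofInjective (sqrtMap q) hq).symm)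
  refine ⟨e, fun v => root.injective ?_⟩
  have : LinearEquiv.ofInjective (sqrtMap q) hq (e v) =
      LinearEquiv.ofEq _ _ h (LinearEquiv.ofInjective (sqrtMap p) hp v) := by simp [e]
  exact congrArg Subtype.val this

theorem Isometric.range_eq {p : QuasilinearForm F V} {q : QuasilinearForm F W}
    (h : Isometric p q) : LinearMap.range (sqrtMap p) = LinearMap.range (sqrtMap q) := by
  obtain ⟨e, he⟩ := h
  have : sqrtMap p = (sqrtMap q).comp e.toLinearMap := by
    ext v
    exact congrArg root (he v).symm
  rw [this, LinearMap.range_comp, LinearEquiv.range, Submodule.map_top]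

theorem Isometric.finrank_eq {p : QuasilinearForm F V} {q : QuasilinearForm F W}
    (h : Isometric p q) : Module.finrank F V = Module.finrank F W := by
  obtain ⟨e, -⟩ := h
  exact e.finrank_eq

theorem range_tensor (p : QuasilinearForm F V) (q : QuasilinearForm F W) :
    LinearMap.range (sqrtMap (tensor p q)) =
      LinearMap.range (sqrtMap p) * LinearMap.range (sqrtMap q) := by
  have ht (v : V) (w : W) : sqrtMap (tensor p q) (v ⊗ₜ w) = sqrtMap p v * sqrtMap q w := by
    rw [sqrtMap_apply, tensor_tmul, map_mul, sqrtMap_apply, sqrtMap_apply]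
  apply le_antisymm
  · rintro _ ⟨z, rfl⟩
    induction z with
    | zero => simp
    | add z z' h h' => rw [map_add]; exact Submodule.add_mem _ h h'
    | tmul v w => rw [ht]; exact Submodule.mul_mem_mul ⟨v, rfl⟩ ⟨w, rfl⟩
  · rw [Submodule.mul_le]
    rintro _ ⟨v, rfl⟩ _ ⟨w, rfl⟩
    exact ⟨v ⊗ₜ w, ht v w⟩

theorem sqrtMap_diagonal {n : ℕ} (a : Fin n → F) (x : Fin n → F) :
    sqrtMap (diagonal a) x = ∑ i, x i • root (a i) := by
  rw [sqrtMap_apply]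
  change root (∑ i, a i * x i ^ 2) = _
  rw [map_sum]
  exact Finset.sum_congr rfl fun i _ => by rw [mul_comm, root_sq_mul]

theorem range_diagonal {n : ℕ} (a : Fin n → F) :
    LinearMap.range (sqrtMap (diagonal a)) = Submodule.span F (Set.range fun i => root (a i)) := by
  have : sqrtMap (diagonal a) = Fintype.linearCombination F fun i => root (a i) := by
    ext x
    simp [sqrtMap_diagonal, Fintype.linearCombination_apply]
  rw [this, Fintype.range_linearCombination]

theorem injective_of_finrank_le [FiniteDimensional F V] {q : QuasilinearForm F V}
    (h : Module.finrank F V ≤ Module.finrank F (LinearMap.range (sqrtMap q))) :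
    Function.Injective (sqrtMap q) := by
  have := LinearMap.finrank_range_add_finrank_ker (sqrtMap q)
  rw [← LinearMap.ker_eq_bot]
  exact Submodule.finrank_eq_zero.1 (by omega)

/-- Every finite-dimensional subspace of `F^{1/2}` consists of the roots of the values of an
anisotropic form. -/
theorem exists_form_of_submodule (R : Submodule F (SqrtExt F)) [FiniteDimensional F R] :
    ∃ r : QuasilinearForm F (Fin (Module.finrank F R) → F),
      Function.Injective (sqrtMap r) ∧ LinearMap.range (sqrtMap r) = R := by
  let e := (Module.finBasis F R).equivFun.symm
  refine ⟨ofLinearMap (R.subtype.comp e.toLinearMap), ?_, ?_⟩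
  · rw [sqrtMap_ofLinearMap]
    exact R.injective_subtype.comp e.injective
  · rw [sqrtMap_ofLinearMap, LinearMap.range_comp, LinearEquiv.range, Submodule.map_top,
      Submodule.range_subtype]

theorem exists_isometric_coordinate [FiniteDimensional F V] (q : QuasilinearForm F V) :
    ∃ q' : QuasilinearForm F (Fin (Module.finrank F V) → F), Isometric q' q := by
  let e := (Module.finBasis F V).equivFun.symm
  exact ⟨ofLinearMap ((sqrtMap q).comp e.toLinearMap), e, fun v => rfl⟩

/-- A complement of the smaller image inside the larger one carries the orthogonal summand; it is
obtained by intersecting a complement in all of $F^{1/2}$ with the larger image, using the modular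
law. -/
theorem isSubform_of_range_le {r : QuasilinearForm F V} {q : QuasilinearForm F W}
    [FiniteDimensional F W]
    (hr : Function.Injective (sqrtMap r)) (hq : Function.Injective (sqrtMap q))
    (h : LinearMap.range (sqrtMap r) ≤ LinearMap.range (sqrtMap q)) : IsSubform r q := by
  obtain ⟨C', hC'⟩ := Submodule.exists_isCompl (LinearMap.range (sqrtMap r))
  set R := LinearMap.range (sqrtMap r)
  set Q := LinearMap.range (sqrtMap q)
  have hfin : FiniteDimensional F (C' ⊓ Q : Submodule F (SqrtExt F)) :=
    Submodule.finiteDimensional_of_le inf_le_right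
  obtain ⟨s, hs, hsr⟩ := exists_form_of_submodule (C' ⊓ Q)
  refine ⟨_, s, isometric_of_range_eq hq ?_ ?_⟩
  · rw [← LinearMap.ker_eq_bot, LinearMap.ker_eq_bot']
    rintro ⟨a, b⟩ hab
    have h0 : sqrtMap r a + sqrtMap s b = 0 := by
      rw [← hab]; exact (map_add root _ _).symm
    have h1 : sqrtMap s b ∈ R := by
      rw [eq_neg_of_add_eq_zero_right h0]
      exact R.neg_mem ⟨a, rfl⟩
    have h2 : sqrtMap s b ∈ C' ⊓ Q := hsr.le ⟨b, rfl⟩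
    have h3 : sqrtMap s b = 0 := by
      have := hC'.disjoint.le_bot ⟨h1, h2.1⟩
      simpa using this
    rw [h3, add_zero] at h0
    rw [Prod.mk_eq_zero]
    exact ⟨(map_eq_zero_iff _ hr).1 h0, (map_eq_zero_iff _ hs).1 h3⟩
  · have h1 : LinearMap.range (sqrtMap (orthogonalSum r s)) = R ⊔ (C' ⊓ Q) := by
      have : sqrtMap (orthogonalSum r s) = (sqrtMap r).coprod (sqrtMap s) := by
        apply LinearMap.ext
        rintro ⟨a, b⟩
        exact map_add root _ _
      rw [this, LinearMap.range_coprod, hsr]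
    rw [h1, ← sup_inf_assoc_of_le _ h, hC'.sup_eq_top, top_inf_eq]

/-! ### Quasi-Pfister forms and subfields of $F^{1/2}$. -/

/-- The roots of the values of a quasi-Pfister form make up a field. -/
theorem IsQuasiPfister.exists_range_eq : ∀ {n m : ℕ} {π : QuasilinearForm F (Fin m → F)},
    IsQuasiPfister n π → Module.finrank F (Fin m → F) = 2 ^ n ∧
      ∃ P : IntermediateField F (SqrtExt F),
        LinearMap.range (sqrtMap π) = Subalgebra.toSubmodule P.toSubalgebra := by
  intro n
  induction n with
  | zero =>
    intro m π h
    refine ⟨by rw [h.finrank_eq]; simp, ⊥, ?_⟩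
    rw [h.range_eq, range_diagonal, IntermediateField.bot_toSubalgebra, Algebra.toSubmodule_bot,
      Submodule.one_eq_span]
    simp
  | succ n ih =>
    rintro m π ⟨a, ha, k, ρ, hρ, h⟩
    obtain ⟨hk, P, hP⟩ := ih hρ
    refine ⟨by rw [h.finrank_eq, Module.finrank_tensorProduct, hk]; simp [pow_succ, mul_comm], ?_⟩
    have h1 : (Set.range fun i => root (![1, -a] i)) = {1, root (-a)} := by
      ext z
      simp only [Set.mem_range, Fin.exists_fin_two, Set.mem_insert_iff, Set.mem_singleton_iff]
      simp [eq_comm]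
    have hr : LinearMap.range (sqrtMap π) =
        Submodule.span F {1, root (-a)} * Subalgebra.toSubmodule P.toSubalgebra := by
      rw [h.range_eq, range_tensor, hP, range_diagonal, h1]
    -- The span is closed under multiplication because the square of `root (-a)` lies in $F$.
    have h2 : Submodule.span F {1, root (-a)} * Submodule.span F {1, root (-a)} ≤
        Submodule.span F {1, root (-a)} := by
      rw [Submodule.span_mul_span, Submodule.span_le]
      rintro _ ⟨x, hx, y, hy, rfl⟩
      have h1m : (1 : SqrtExt F) ∈ Submodule.span F {1, root (-a)} :=
        Submodule.subset_span (by simp)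
      have ham : root (-a) ∈ Submodule.span F {1, root (-a)} :=
        Submodule.subset_span (by simp)
      rcases hx with rfl | rfl <;> rcases hy with rfl | rfl
      · simpa using h1m
      · simpa using ham
      · simpa using ham
      · simp only [root_mul_self, Algebra.algebraMap_eq_smul_one]
        exact Submodule.smul_mem _ _ h1m
    have h3 : Subalgebra.toSubmodule P.toSubalgebra * Subalgebra.toSubmodule P.toSubalgebra =
        Subalgebra.toSubmodule P.toSubalgebra := P.toSubalgebra.isIdempotentElem_toSubmodule
    let S : Subalgebra F (SqrtExt F) := Submodule.toSubalgebra
      (Submodule.span F {1, root (-a)} * Subalgebra.toSubmodule P.toSubalgebra)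
      (by
        rw [← mul_one (1 : SqrtExt F)]
        exact Submodule.mul_mem_mul (Submodule.subset_span (by simp)) P.one_mem)
      (by
        intro x y hx hy
        have := Submodule.mul_mem_mul hx hy
        rw [mul_mul_mul_comm, h3] at this
        exact (mul_le_mul' h2 le_rfl) this)
    exact ⟨toIntermediateField S, hr⟩

/-- The image of a product $\pi \otimes r$ is a product of subspaces whose first factor is a field,
so it is stable under that field. The degree is $2^n$ and not smaller because $\pi$ inherits
anisotropy from $q$. -/
theorem exists_field_of_isDivisibleByQuasiPfister {n : ℕ} {q : QuasilinearForm F V}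
    (hq : Anisotropic q) (h0 : LinearMap.range (sqrtMap q) ≠ ⊥)
    (h : IsDivisibleByQuasiPfister n q) :
    ∃ P : IntermediateField F (SqrtExt F), Module.finrank F P = 2 ^ n ∧
      ∀ t ∈ P, ∀ z ∈ LinearMap.range (sqrtMap q), t * z ∈ LinearMap.range (sqrtMap q) := by
  obtain ⟨m, π, hπ, l, r, hr⟩ := h
  obtain ⟨hd, P, hP⟩ := hπ.exists_range_eq
  have hrange : LinearMap.range (sqrtMap q) =
      Subalgebra.toSubmodule P.toSubalgebra * LinearMap.range (sqrtMap r) := by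
    rw [hr.range_eq, range_tensor, hP]
  refine ⟨P, ?_, ?_⟩
  -- If $x$ is isotropic for $\pi$ and $w \neq 0$, then $x \otimes w$ is a nonzero isotropic vector
  -- of $\pi \otimes r$. Such a $w$ exists since $q$ has a nonzero value.
  · have hinj : Function.Injective (sqrtMap π) := by
      rw [← LinearMap.ker_eq_bot, LinearMap.ker_eq_bot']
      intro x hx
      by_contra hx0
      have : ∃ w : Fin l → F, w ≠ 0 := by
        by_contra! hw
        apply h0
        rw [hrange, eq_bot_iff, Submodule.mul_le]
        rintro t - _ ⟨w, rfl⟩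
        rw [hw w, map_zero, mul_zero]
        exact Submodule.zero_mem _
      obtain ⟨w, hw⟩ := this
      obtain ⟨e, he⟩ := hr
      have h1 : q (e.symm (x ⊗ₜ w)) = 0 := by
        rw [← he, LinearEquiv.apply_symm_apply, tensor_tmul]
        rw [sqrtMap_apply, map_eq_zero_iff _ root.injective] at hx
        rw [hx, zero_mul]
      have h2 := hq _ h1
      rw [LinearEquiv.map_eq_zero_iff] at h2
      obtain ⟨i, hi⟩ := Function.ne_iff.1 hx0
      obtain ⟨j, hj⟩ := Function.ne_iff.1 hw
      have h3 := congrArg (TensorProduct.lid F F ∘ TensorProduct.map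
        (LinearMap.proj (φ := fun _ => F) i) (LinearMap.proj (φ := fun _ => F) j)) h2
      simp only [Function.comp_apply, TensorProduct.map_tmul, LinearMap.proj_apply,
        TensorProduct.lid_tmul, smul_eq_mul, map_zero] at h3
      exact mul_ne_zero hi hj h3
    rw [← hd, ← LinearMap.finrank_range_of_inj hinj, hP]
    rfl
  · intro t ht z hz
    rw [hrange] at hz ⊢
    have := Submodule.mul_mem_mul (show t ∈ Subalgebra.toSubmodule P.toSubalgebra from ht) hz
    rwa [← mul_assoc, P.toSubalgebra.isIdempotentElem_toSubmodule] at this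

/-- Inside a subfield of `F^{1/2}` of large degree one finds the roots of the values of an
anisotropic quasi-Pfister form. -/
theorem exists_isQuasiPfister (M : IntermediateField F (SqrtExt F)) (T : Submodule F (SqrtExt F))
    (hT : ∀ t ∈ T, t ∈ M) : ∀ e : ℕ, 2 ^ e ≤ Module.finrank F T →
    ∃ (m : ℕ) (π : QuasilinearForm F (Fin m → F)) (P : IntermediateField F (SqrtExt F)),
      IsQuasiPfister e π ∧ Function.Injective (sqrtMap π) ∧
      LinearMap.range (sqrtMap π) = Subalgebra.toSubmodule P.toSubalgebra ∧ P ≤ M := by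
  intro e
  induction e with
  | zero =>
    intro _
    have h0 : IsQuasiPfister 0 (diagonal ![(1 : F)]) := ⟨LinearEquiv.refl _ _, fun _ => rfl⟩
    refine ⟨1, diagonal ![1], ⊥, h0, ?_, ?_, bot_le⟩
    · rw [← LinearMap.ker_eq_bot, LinearMap.ker_eq_bot']
      intro x hx
      rw [sqrtMap_diagonal] at hx
      funext i
      rw [Subsingleton.elim i 0]
      simpa using hx
    · rw [range_diagonal, IntermediateField.bot_toSubalgebra, Algebra.toSubmodule_bot,
        Submodule.one_eq_span]
      simp
  | succ e ih =>
    intro he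
    obtain ⟨k, ρ, P, hρ, hinj, hP, hPM⟩ := ih (le_trans (Nat.pow_le_pow_right two_pos e.le_succ) he)
    have hk := hρ.exists_range_eq.1
    have hPfin : Module.finrank F P = 2 ^ e := by
      rw [← hk, ← LinearMap.finrank_range_of_inj hinj, hP]
      rfl
    have : FiniteDimensional F P := Module.finite_of_finrank_pos (by rw [hPfin]; positivity)
    obtain ⟨t, htT, htP⟩ : ∃ t ∈ T, t ∉ P := by
      -- Otherwise $T \subseteq P$, which has dimension only $2^e$.
      by_contra! hcon
      have : Module.finrank F T ≤ Module.finrank F P :=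
        Submodule.finrank_mono (s := T) (t := Subalgebra.toSubmodule P.toSubalgebra) hcon
      rw [hPfin] at this
      have h3 := he.trans this
      rw [pow_succ] at h3
      have : 0 < 2 ^ e := by positivity
      omega
    have ht0 : t ≠ 0 := by rintro rfl; exact htP P.zero_mem
    obtain ⟨π, hπ⟩ := exists_isometric_coordinate (tensor (diagonal ![1, -(root.symm t)]) ρ)
    have hQ : IsQuasiPfister (e + 1) π :=
      ⟨root.symm t, by rwa [Ne, map_eq_zero_iff _ root.symm.injective], k, ρ, hρ, hπ⟩
    obtain ⟨hdim, P', hP'⟩ := hQ.exists_range_eq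
    have hr : LinearMap.range (sqrtMap π) = Submodule.span F {1, t} *
        Subalgebra.toSubmodule P.toSubalgebra := by
      have hneg' : -t = t := CharTwo.neg_eq t
      have h1 : (Set.range fun i => root (![1, -(root.symm t)] i)) = {1, t} := by
        ext z
        simp only [Set.mem_range, Fin.exists_fin_two, Set.mem_insert_iff, Set.mem_singleton_iff]
        simp [hneg', eq_comm]
      rw [hπ.range_eq, range_tensor, hP, range_diagonal, h1]
    have hPP' : P ≤ P' := by
      intro z hz
      change z ∈ Subalgebra.toSubmodule P'.toSubalgebra
      rw [← hP', hr, ← one_mul z]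
      exact Submodule.mul_mem_mul (Submodule.subset_span (by simp)) hz
    have htP' : t ∈ P' := by
      change t ∈ Subalgebra.toSubmodule P'.toSubalgebra
      rw [← hP', hr, ← mul_one t]
      exact Submodule.mul_mem_mul (Submodule.subset_span (by simp)) P.one_mem
    have hfr : Module.finrank F (LinearMap.range (sqrtMap π)) = Module.finrank F P' := by
      rw [hP']; rfl
    have hP'fin : FiniteDimensional F P' := by
      change FiniteDimensional F (Subalgebra.toSubmodule P'.toSubalgebra)
      rw [← hP']; infer_instance
    refine ⟨_, π, P', hQ, injective_of_finrank_le ?_, hP', ?_⟩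
    · rw [hdim, hfr]
      -- The degree of $P'$ is a multiple of $2^e$ and exceeds $2^e$, so it is at least $2^{e+1}$,
      -- the dimension of the space of `π`.
      have hmul := finrank_mul_finrank_extendSubmodule P (Subalgebra.toSubmodule P'.toSubalgebra)
        (fun a ha b hb => P'.mul_mem (hPP' ha) hb)
      have hlt : Module.finrank F P < Module.finrank F P' :=
        Submodule.finrank_lt_finrank_of_lt (s := Subalgebra.toSubmodule P.toSubalgebra)
          (t := Subalgebra.toSubmodule P'.toSubalgebra)
          (lt_of_le_not_ge hPP' fun hle => htP (hle htP'))
      change _ = Module.finrank F P' at hmul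
      rw [hPfin] at hmul hlt
      rw [pow_succ, ← hmul]
      refine Nat.mul_le_mul_left _ ?_
      by_contra! hcon
      rw [← hmul] at hlt
      interval_cases h : Module.finrank P (extendSubmodule P
        (Subalgebra.toSubmodule P'.toSubalgebra) (fun a ha b hb => P'.mul_mem (hPP' ha) hb)) <;>
      omega
    · intro z hz
      have hz' : z ∈ Subalgebra.toSubmodule P'.toSubalgebra := hz
      rw [← hP', hr] at hz'
      have hle : Submodule.span F {1, t} * Subalgebra.toSubmodule P.toSubalgebra ≤
          Subalgebra.toSubmodule M.toSubalgebra := by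
        rw [← M.toSubalgebra.isIdempotentElem_toSubmodule]
        refine mul_le_mul' (Submodule.span_le.2 ?_) hPM
        rintro x (rfl | rfl)
        · exact M.one_mem
        · exact hT _ htT
      exact hle hz'

/-- An anisotropic form whose values are stable under a large subfield of `F^{1/2}` is divisible by
a quasi-Pfister form. -/
theorem isDivisibleByQuasiPfister_of_stable [FiniteDimensional F V] {q : QuasilinearForm F V}
    (hq : Function.Injective (sqrtMap q)) (T : Submodule F (SqrtExt F))
    (hT : ∀ t ∈ T, ∀ z ∈ LinearMap.range (sqrtMap q), t * z ∈ LinearMap.range (sqrtMap q))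
    {e : ℕ} (he : 2 ^ e ≤ Module.finrank F T) : IsDivisibleByQuasiPfister e q := by
  obtain ⟨m, π, P, hπ, hinj, hP, hPM⟩ := exists_isQuasiPfister
    (stabilizer (LinearMap.range (sqrtMap q))) T hT e he
  obtain ⟨l, y, hl, hy⟩ := exists_basis_of_stable P (LinearMap.range (sqrtMap q))
    fun t ht => hPM ht
  have hfr : Module.finrank F P = Module.finrank F (Fin m → F) := by
    rw [← LinearMap.finrank_range_of_inj hinj, hP]
    rfl
  have hr : LinearMap.range (sqrtMap (tensor π (diagonal fun i => root.symm (y i)))) =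
      LinearMap.range (sqrtMap q) := by
    rw [range_tensor, hP, range_diagonal, ← hy]
    simp
  refine ⟨m, π, hπ, l, diagonal fun i => root.symm (y i), isometric_of_range_eq hq ?_ hr.symm⟩
  -- The tensor product has the same dimension as its image, hence is anisotropic.
  apply injective_of_finrank_le
  rw [hr, hl, Module.finrank_tensorProduct, hfr]
  simp

end SqrtMap

/-! ### Scalar extension of forms in terms of square roots. -/

section BaseChange

variable {F : Type*} [Field F] [CharP F 2] {V : Type*} [AddCommGroup V] [Module F V]
variable (E : Type*) [Field E] [CharP E 2] [Algebra F E]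

theorem sqrtMap_baseChange_tmul (q : QuasilinearForm F V) (x : E) (v : V) :
    sqrtMap (baseChange E q) (x ⊗ₜ v) = x • SqrtExt.map F E (sqrtMap q v) := by
  rw [sqrtMap_apply, baseChange_tmul, root_sq_mul, sqrtMap_apply, map_root]

theorem sqrtMap_baseChange_eq_sum {ι : Type*} [Fintype ι] (b : Module.Basis ι F V)
    (q : QuasilinearForm F V) (z : E ⊗[F] V) :
    sqrtMap (baseChange E q) z =
      ∑ i, (b.baseChange E).repr z i • SqrtExt.map F E (sqrtMap q (b i)) := by
  conv_lhs => rw [← (b.baseChange E).sum_repr z]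
  rw [map_sum]
  refine Finset.sum_congr rfl fun i _ => ?_
  rw [LinearMap.map_smul, Module.Basis.baseChange_apply, sqrtMap_baseChange_tmul, one_smul]

theorem range_baseChange_eq_span (q : QuasilinearForm F V) :
    LinearMap.range (sqrtMap (baseChange E q)) =
      Submodule.span E (Set.range fun v => SqrtExt.map F E (sqrtMap q v)) := by
  apply le_antisymm
  · rintro _ ⟨z, rfl⟩
    induction z with
    | zero => simp
    | add z z' h h' => rw [map_add]; exact Submodule.add_mem _ h h'
    | tmul x v =>
      rw [sqrtMap_baseChange_tmul]
      exact Submodule.smul_mem _ _ (Submodule.subset_span ⟨v, rfl⟩)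
  · rw [Submodule.span_le]
    rintro _ ⟨v, rfl⟩
    exact ⟨1 ⊗ₜ v, by rw [sqrtMap_baseChange_tmul, one_smul]⟩

end BaseChange

/-! ### Isotropic vectors over the function field of a quadric. -/

/-- `E` is the function field of the quadric `b₀ + b₁ Y² + ∑ bᵢ Xᵢ² = 0` over `F`, with coordinate
functions `y` and `xᵢ`: it is generated by the coordinates, and `1, y` are linearly independent over
the polynomials in the `xᵢ`. -/
structure IsQuadricFunctionField {F E σ : Type*} [Field F] [Field E] [Algebra F E] [Fintype σ]
    (b₀ b₁ : F) (b : σ → F) (x : σ → E) (y : E) : Prop where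
  ne_zero : b₁ ≠ 0
  equation : algebraMap F E b₀ + algebraMap F E b₁ * y ^ 2 + ∑ i, algebraMap F E (b i) * x i ^ 2 = 0
  adjoin_eq_top : IntermediateField.adjoin F (insert y (Set.range x)) = ⊤
  indep : ∀ f g : MvPolynomial σ F,
    MvPolynomial.aeval x f + MvPolynomial.aeval x g * y = 0 → f = 0 ∧ g = 0

namespace IsQuadricFunctionField

variable {F E σ : Type*} [Field F] [CharP F 2] [Field E] [CharP E 2] [Algebra F E] [Fintype σ]
variable {b₀ b₁ : F} {b : σ → F} {x : σ → E} {y : E}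

omit [CharP F 2] [CharP E 2] in
theorem eq_zero_of_aeval_eq_zero (h : IsQuadricFunctionField b₀ b₁ b x y)
    {f : MvPolynomial σ F} (hf : MvPolynomial.aeval x f = 0) : f = 0 :=
  (h.indep f 0 (by simp [hf])).1

variable (F x) in
/-- Evaluation of polynomials over `F^{1/2}` at the coordinates `xᵢ`. -/
noncomputable def sqrtEval : MvPolynomial σ (SqrtExt F) →+* SqrtExt E :=
  MvPolynomial.eval₂Hom (SqrtExt.map F E) fun i => algebraMap E (SqrtExt E) (x i)

omit [CharP F 2] [Fintype σ] in
theorem sqrtEval_C (a : SqrtExt F) : sqrtEval F x (MvPolynomial.C a) = SqrtExt.map F E a := by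
  simp [sqrtEval]

omit [CharP F 2] [Fintype σ] in
theorem sqrtEval_X (i : σ) :
    sqrtEval F x (MvPolynomial.X i) = algebraMap E (SqrtExt E) (x i) := by
  simp [sqrtEval]

omit [Fintype σ] in
theorem sqrtEval_map (f : MvPolynomial σ F) :
    sqrtEval F x (MvPolynomial.map (algebraMap F (SqrtExt F)) f) =
      algebraMap E (SqrtExt E) (MvPolynomial.aeval x f) := by
  induction f using MvPolynomial.induction_on with
  | C a => simp [sqrtEval_C, map_algebraMap]
  | add f g hf hg => simp [hf, hg]
  | mul_X f i hf => simp [hf, sqrtEval_X]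

-- Squaring a value turns it into the value at $x$ of a polynomial over $F$ in the $X_i^2$, whose
-- coefficients are the squares of the original ones. The $x_i$ are algebraically independent over
-- $F$, so that polynomial vanishes.
omit [CharP F 2] in
theorem sqrtEval_injective (h : IsQuadricFunctionField b₀ b₁ b x y) :
    Function.Injective (sqrtEval F x) := by
  rw [injective_iff_map_eq_zero]
  intro P hP
  have h1 : ∀ P : MvPolynomial σ (SqrtExt F), root.symm (sqrtEval F x P) = MvPolynomial.aeval x
      (MvPolynomial.expand 2 (MvPolynomial.map (root (F := F)).symm.toRingHom P)) := by
    intro P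
    induction P using MvPolynomial.induction_on with
    | C a =>
      simp [sqrtEval_C]
      rfl
    | add f g hf hg => simp only [map_add, hf, hg]
    | mul_X f i hf =>
      simp only [map_mul, hf, sqrtEval_X, MvPolynomial.map_X, MvPolynomial.expand_X, map_pow,
        MvPolynomial.aeval_X, SqrtExt.algebraMap_apply, RingEquiv.symm_apply_apply]
  have h2 := h1 P
  rw [hP, map_zero] at h2
  have h3 := h.eq_zero_of_aeval_eq_zero h2.symm
  have h4 := MvPolynomial.expand_injective two_pos (h3.trans (map_zero _).symm)
  exact MvPolynomial.map_injective _ (root (F := F)).symm.injective (h4.trans (map_zero _).symm)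

variable (F x) in
/-- The purely transcendental subfield generated by the coordinates `xᵢ`. -/
noncomputable abbrev base : IntermediateField F E := IntermediateField.adjoin F (Set.range x)

omit [CharP F 2] [CharP E 2] [Fintype σ] in
theorem exists_common_denominator {J : Type*} [Fintype J] (κ : J → E) (hκ : ∀ j, κ j ∈ base F x) :
    ∃ (h : MvPolynomial σ F) (g : J → MvPolynomial σ F), MvPolynomial.aeval x h ≠ 0 ∧
      ∀ j, MvPolynomial.aeval x h * κ j = MvPolynomial.aeval x (g j) := by
  classical
  have h1 : ∀ j, ∃ r s : MvPolynomial σ F, MvPolynomial.aeval x s ≠ 0 ∧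
      MvPolynomial.aeval x s * κ j = MvPolynomial.aeval x r := by
    intro j
    obtain ⟨r, s, hrs⟩ := (IntermediateField.mem_adjoin_range_iff F x (κ j)).1 (hκ j)
    by_cases hs : MvPolynomial.aeval x s = 0
    · exact ⟨0, 1, by simp, by simp [hrs, hs]⟩
    · exact ⟨r, s, hs, by rw [hrs]; field_simp⟩
  choose r s hs hrs using h1
  refine ⟨∏ j, s j, fun j => r j * ∏ k ∈ Finset.univ.erase j, s k, ?_, fun j => ?_⟩
  · rw [map_prod]
    exact Finset.prod_ne_zero_iff.2 fun j _ => hs j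
  · rw [← Finset.mul_prod_erase _ _ (Finset.mem_univ j), map_mul, map_mul, ← hrs]
    ring

/-- Elements of $F^{1/2}$ independent over $F$ stay independent over the purely transcendental field
$K = F(x_i)$: clear denominators, then compare coefficients of the resulting polynomial relation
over $F^{1/2}$. In other words, anisotropic forms remain anisotropic over $K$. -/
theorem eq_zero_of_sum_eq_zero (h : IsQuadricFunctionField b₀ b₁ b x y) {J : Type*} [Fintype J]
    {ρ : J → SqrtExt F} (hρ : LinearIndependent F ρ) (κ : J → E) (hκ : ∀ j, κ j ∈ base F x)
    (h0 : ∑ j, κ j • SqrtExt.map F E (ρ j) = 0) (j : J) : κ j = 0 := by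
  obtain ⟨d, g, hd, hg⟩ := exists_common_denominator κ hκ
  have h1 : sqrtEval F x (∑ j, MvPolynomial.C (ρ j) *
      MvPolynomial.map (algebraMap F (SqrtExt F)) (g j)) = 0 := by
    have h2 := congrArg (fun z => algebraMap E (SqrtExt E) (MvPolynomial.aeval x d) * z) h0
    simp only [mul_zero, Finset.mul_sum] at h2
    rw [map_sum, ← h2]
    refine Finset.sum_congr rfl fun j _ => ?_
    rw [map_mul, sqrtEval_C, sqrtEval_map, ← hg, map_mul, Algebra.smul_def]
    ring
  have h2 := (injective_iff_map_eq_zero _).1 h.sqrtEval_injective _ h1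
  have h3 : g j = 0 := by
    ext m
    have h4 := congrArg (MvPolynomial.coeff m) h2
    rw [MvPolynomial.coeff_sum, MvPolynomial.coeff_zero] at h4
    refine Fintype.linearIndependent_iff.1 hρ (fun j => MvPolynomial.coeff m (g j)) ?_ j
    rw [← h4]
    refine Finset.sum_congr rfl fun j _ => ?_
    rw [MvPolynomial.coeff_C_mul, MvPolynomial.coeff_map, Algebra.smul_def, mul_comm]
  have h4 := hg j
  rw [h3, map_zero] at h4
  exact (mul_eq_zero.1 h4).resolve_left hd

omit [CharP F 2] [CharP E 2] in
theorem sq_mem_base (h : IsQuadricFunctionField b₀ b₁ b x y) : y ^ 2 ∈ base F x := by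
  have hb : algebraMap F E b₁ ≠ 0 := by simpa using h.ne_zero
  have h1 : y ^ 2 = -(algebraMap F E b₁)⁻¹ *
      (algebraMap F E b₀ + ∑ i, algebraMap F E (b i) * x i ^ 2) := by
    have := h.equation
    field_simp
    linear_combination this
  rw [h1]
  have hx : ∀ i, x i ∈ base F x := fun i => IntermediateField.subset_adjoin _ _ ⟨i, rfl⟩
  exact mul_mem (neg_mem (inv_mem (algebraMap_mem _ _)))
    (add_mem (algebraMap_mem _ _)
      (sum_mem fun i _ => mul_mem (algebraMap_mem _ _) (pow_mem (hx i) 2)))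

omit [CharP F 2] in
theorem exists_decomposition (h : IsQuadricFunctionField b₀ b₁ b x y) (e : E) :
    ∃ α ∈ base F x, ∃ β ∈ base F x, e = α + β * y := by
  have he : e ∈ IntermediateField.adjoin F (insert y (Set.range x)) := by
    rw [h.adjoin_eq_top]; trivial
  have hy := h.sq_mem_base
  have hmul : ∀ e e', (∃ α ∈ base F x, ∃ β ∈ base F x, e = α + β * y) →
      (∃ α ∈ base F x, ∃ β ∈ base F x, e' = α + β * y) →
      ∃ α ∈ base F x, ∃ β ∈ base F x, e * e' = α + β * y := by
    rintro _ _ ⟨α, hα, β, hβ, rfl⟩ ⟨α', hα', β', hβ', rfl⟩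
    exact ⟨α * α' + β * β' * y ^ 2, add_mem (mul_mem hα hα') (mul_mem (mul_mem hβ hβ') hy),
      α * β' + β * α', add_mem (mul_mem hα hβ') (mul_mem hβ hα'), by ring⟩
  induction he using IntermediateField.adjoin_induction with
  | mem z hz =>
    rcases hz with rfl | hz
    · exact ⟨0, zero_mem _, 1, one_mem _, by ring⟩
    · exact ⟨z, IntermediateField.subset_adjoin _ _ hz, 0, zero_mem _, by ring⟩
  | algebraMap a => exact ⟨_, algebraMap_mem _ a, 0, zero_mem _, by ring⟩
  | add e e' _ _ he he' =>
    obtain ⟨α, hα, β, hβ, rfl⟩ := he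
    obtain ⟨α', hα', β', hβ', rfl⟩ := he'
    exact ⟨α + α', add_mem hα hα', β + β', add_mem hβ hβ', by ring⟩
  | inv e _ he =>
    -- In characteristic 2, $(\alpha + \beta y)^2 = \alpha^2 + \beta^2 y^2$ lies in $K$, so only an
    -- inverse in $K$ is needed.
    have h1 : e⁻¹ = e * (e ^ 2)⁻¹ := by
      by_cases h0 : e = 0
      · simp [h0]
      · field_simp
    rw [h1]
    refine hmul _ _ he ?_
    obtain ⟨α, hα, β, hβ, rfl⟩ := he
    refine ⟨_, inv_mem (x := (α + β * y) ^ 2) ?_, 0, zero_mem _, by ring⟩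
    rw [CharTwo.add_sq, mul_pow]
    exact add_mem (pow_mem hα 2) (mul_mem (pow_mem hβ 2) hy)
  | mul e e' _ _ he he' => exact hmul _ _ he he'

omit [CharP F 2] [CharP E 2] in
theorem eq_zero_of_add_mul_eq_zero (h : IsQuadricFunctionField b₀ b₁ b x y) {α β : E}
    (hα : α ∈ base F x) (hβ : β ∈ base F x) (h0 : α + β * y = 0) : α = 0 ∧ β = 0 := by
  obtain ⟨d, g, hd, hg⟩ := exists_common_denominator (F := F) (x := x) ![α, β]
    (by intro j; fin_cases j <;> assumption)
  have hg0 := hg 0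
  have hg1 := hg 1
  simp only [Matrix.cons_val_zero, Matrix.cons_val_one] at hg0 hg1
  obtain ⟨h1, h2⟩ := h.indep (g 0) (g 1) (by
    rw [← hg0, ← hg1]; linear_combination MvPolynomial.aeval x d * h0)
  rw [h1, map_zero] at hg0
  rw [h2, map_zero] at hg1
  exact ⟨(mul_eq_zero.1 hg0).resolve_left hd, (mul_eq_zero.1 hg1).resolve_left hd⟩

omit [CharP F 2] in
/-- The derivative with respect to the coordinate `y`. -/
theorem exists_derivation (h : IsQuadricFunctionField b₀ b₁ b x y) :
    ∃ δ : E → E, (∀ α ∈ base F x, ∀ β ∈ base F x, δ (α + β * y) = β) ∧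
      (∀ e, δ e ∈ base F x) ∧ (∀ e e', δ (e + e') = δ e + δ e') ∧
      ∀ e e', δ (e * e') = e * δ e' + δ e * e' := by
  choose α hα β hβ hdec using h.exists_decomposition
  have key : ∀ a ∈ base F x, ∀ c ∈ base F x, β (a + c * y) = c := by
    intro a ha c hc
    have := (h.eq_zero_of_add_mul_eq_zero (sub_mem ha (hα (a + c * y)))
      (sub_mem hc (hβ (a + c * y))) (by linear_combination hdec (a + c * y))).2
    exact (sub_eq_zero.1 this).symm
  refine ⟨β, key, hβ, fun e e' => ?_, fun e e' => ?_⟩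
  · have h1 : e + e' = (α e + α e') + (β e + β e') * y := by
      linear_combination hdec e + hdec e'
    rw [h1, key _ (add_mem (hα _) (hα _)) _ (add_mem (hβ _) (hβ _))]
  · have h1 : e * e' = (α e * α e' + β e * β e' * y ^ 2) + (α e * β e' + β e * α e') * y := by
      conv_lhs => rw [hdec e, hdec e']
      ring
    rw [h1, key _ (add_mem (mul_mem (hα _) (hα _)) (mul_mem (mul_mem (hβ _) (hβ _)) h.sq_mem_base))
      _ (add_mem (mul_mem (hα _) (hβ _)) (mul_mem (hβ _) (hα _)))]
    conv_rhs => rw [hdec e, hdec e']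
    rw [key _ (hα e) _ (hβ e), key _ (hα e') _ (hβ e')]
    -- The product rule holds because the extra term $2\beta\beta' y$ vanishes.
    linear_combination -(β e * β e' * y) * (CharTwo.two_eq_zero (R := E))

variable {W : Type*} [AddCommGroup W] [Module F W]

-- In characteristic 2 the square root is additive, so the quadratic equation becomes linear over
-- $F^{1/2}$. This allows $y$ to be replaced by a linear polynomial in the $x_i$.
omit [CharP F 2] in
theorem root_mul_coordinate (h : IsQuadricFunctionField b₀ b₁ b x y) :
    y • SqrtExt.map F E (root b₁) =
      SqrtExt.map F E (root b₀) + ∑ i, x i • SqrtExt.map F E (root (b i)) := by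
  simp only [map_root, ← root_sq_mul]
  rw [← map_sum, ← map_add, root.injective.eq_iff]
  have h1 := h.equation
  have h2 : ∑ i, x i ^ 2 * algebraMap F E (b i) = ∑ i, algebraMap F E (b i) * x i ^ 2 :=
    Finset.sum_congr rfl fun i _ => mul_comm _ _
  rw [h2]
  linear_combination h1 - (algebraMap F E b₀ + ∑ i, algebraMap F E (b i) * x i ^ 2) *
    (CharTwo.two_eq_zero (R := E))

/-- Differentiating the equation of an isotropic vector with polynomial coordinates. -/
theorem root_mul_sum_mem (h : IsQuadricFunctionField b₀ b₁ b x y) {J : Type*} [Fintype J]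
    (ρ : J → SqrtExt F) (f g : J → MvPolynomial σ F)
    (h0 : ∑ j, (MvPolynomial.aeval x (f j) + MvPolynomial.aeval x (g j) * y) •
      SqrtExt.map F E (ρ j) = 0) (i : σ) :
    ∃ e : J → E, SqrtExt.map F E (root (b i)) *
        ∑ j, MvPolynomial.aeval x (g j) • SqrtExt.map F E (ρ j) =
      SqrtExt.map F E (root b₁) * ∑ j, e j • SqrtExt.map F E (ρ j) := by
  let ι := MvPolynomial.map (σ := σ) (algebraMap F (SqrtExt F))
  -- `Λ` represents $\sqrt{b_1}\,y$ as a polynomial in the $x_i$, with $\partial\Lambda/\partial X_i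
  -- = \sqrt{b_i}$.
  let Λ : MvPolynomial σ (SqrtExt F) :=
    MvPolynomial.C (root b₀) + ∑ i, MvPolynomial.X i * MvPolynomial.C (root (b i))
  have hΛ : sqrtEval F x Λ = algebraMap E (SqrtExt E) y * SqrtExt.map F E (root b₁) := by
    rw [← Algebra.smul_def, h.root_mul_coordinate]
    simp only [Λ, map_add, map_sum, map_mul, sqrtEval_C, sqrtEval_X, Algebra.smul_def]
  have hd : MvPolynomial.pderiv i Λ = MvPolynomial.C (root (b i)) := by
    classical
    simp only [Λ, map_add, MvPolynomial.pderiv_C, map_sum, Derivation.leibniz, zero_add,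
      MvPolynomial.pderiv_X, smul_eq_mul]
    rw [Finset.sum_eq_single i]
    · simp
    · intro j _ hj; simp [hj]
    · simp
  have h1 : ∑ j, MvPolynomial.C (ρ j) *
      (MvPolynomial.C (root b₁) * ι (f j) + Λ * ι (g j)) = 0 := by
    apply (injective_iff_map_eq_zero _).1 h.sqrtEval_injective
    have h2 := congrArg (fun z => SqrtExt.map F E (root b₁) * z) h0
    simp only [mul_zero, Finset.mul_sum] at h2
    rw [map_sum, ← h2]
    refine Finset.sum_congr rfl fun j _ => ?_
    simp only [map_mul, map_add, sqrtEval_C, hΛ, ι, sqrtEval_map, Algebra.smul_def]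
    ring
  -- By injectivity of `sqrtEval`, the isotropy relation times $\sqrt{b_1}$ is a polynomial identity
  -- and can be differentiated. The term $\sqrt{b_i}\sum_j g_j\rho_j$ comes from differentiating
  -- `Λ`; every other term is a multiple of $\sqrt{b_1}$.
  have h2 := congrArg (fun P => sqrtEval F x (MvPolynomial.pderiv i P)) h1
  simp only [map_sum, map_zero, Derivation.leibniz, MvPolynomial.pderiv_C,
    map_add, hd, smul_eq_mul, map_mul, hΛ, sqrtEval_C, ι, MvPolynomial.pderiv_map,
    sqrtEval_map] at h2
  refine ⟨fun j => MvPolynomial.aeval x (MvPolynomial.pderiv i (f j)) +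
    y * MvPolynomial.aeval x (MvPolynomial.pderiv i (g j)), ?_⟩
  rw [← sub_eq_zero, ← h2, Finset.mul_sum, Finset.mul_sum, ← Finset.sum_sub_distrib]
  refine Finset.sum_congr rfl fun j _ => ?_
  simp only [Algebra.smul_def, map_add, map_mul]
  rw [CharTwo.sub_eq_add]
  ring

omit [CharP E 2] in
/-- A derivation, applied to the coordinates of the vectors in the kernel of a linear map, induces
a linear map on this kernel. -/
theorem exists_submodule_of_derivation {M N J : Type*} [AddCommGroup M] [Module E M]
    [AddCommGroup N] [Module E N] [Fintype J] (s : M →ₗ[E] N) (c : M ≃ₗ[E] (J → E)) (r : J → N)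
    (hc : ∀ z, s z = ∑ j, c z j • r j) (δ : E → E) (hδadd : ∀ e e', δ (e + e') = δ e + δ e')
    (hδmul : ∀ e e', δ (e * e') = e * δ e' + δ e * e')
    (hinj : ∀ z, s z = 0 → ∑ j, δ (c z j) • r j = 0 → z = 0) :
    ∃ U : Submodule E N, Module.finrank E U = Module.finrank E (LinearMap.ker s) ∧
      ∀ u ∈ U, ∃ z, s z = 0 ∧ u = ∑ j, δ (c z j) • r j := by
  let Φ : LinearMap.ker s →ₗ[E] N :=
    { toFun := fun z => ∑ j, δ (c z j) • r j
      map_add' := fun z z' => by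
        rw [← Finset.sum_add_distrib]
        refine Finset.sum_congr rfl fun j _ => ?_
        rw [Submodule.coe_add, map_add, Pi.add_apply, hδadd, add_smul]
      map_smul' := fun e z => by
        have h0 := z.2
        rw [LinearMap.mem_ker, hc] at h0
        -- This is the defect of linearity in the Leibniz rule; it vanishes since $z$ lies in the
        -- kernel.
        have h1 : ∑ j, (δ e * c z j) • r j = 0 := by
          rw [← smul_zero (δ e), ← h0, Finset.smul_sum]
          exact Finset.sum_congr rfl fun j _ => mul_smul _ _ _
        rw [RingHom.id_apply, Finset.smul_sum, ← add_zero (∑ j, e • _), ← h1,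
          ← Finset.sum_add_distrib]
        refine Finset.sum_congr rfl fun j _ => ?_
        rw [Submodule.coe_smul, map_smul, Pi.smul_apply, smul_eq_mul, hδmul, add_smul, mul_smul] }
  have hΦ : Function.Injective Φ := (injective_iff_map_eq_zero Φ).2 fun z hz =>
    Subtype.ext (hinj z z.2 hz)
  refine ⟨LinearMap.range Φ, LinearMap.finrank_range_of_inj hΦ, ?_⟩
  rintro _ ⟨z, rfl⟩
  exact ⟨z, z.2, rfl⟩

/-- The isotropic vectors of an anisotropic form over the function field of a quadric give rise to a
space which is carried by the values of the equation of the quadric into the values of the form. -/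
theorem exists_submodule_mul_mem [FiniteDimensional F W]
    (h : IsQuadricFunctionField b₀ b₁ b x y) (q : QuasilinearForm F W) (hq : Anisotropic q) :
    ∃ U : Submodule E (SqrtExt E), Module.finrank E U = isotropyIndex (baseChange E q) ∧
      ∀ u ∈ U, SqrtExt.map F E (root b₀) * u ∈ LinearMap.range (sqrtMap (baseChange E q)) ∧
        SqrtExt.map F E (root b₁) * u ∈ LinearMap.range (sqrtMap (baseChange E q)) ∧
        ∀ i, SqrtExt.map F E (root (b i)) * u ∈ LinearMap.range (sqrtMap (baseChange E q)) := by
  obtain ⟨δ, hδ, hδK, hδadd, hδmul⟩ := h.exists_derivation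
  let w := Module.finBasis F W
  let ρ := fun j => sqrtMap q (w j)
  have hρ : LinearIndependent F ρ :=
    w.linearIndependent.map' (sqrtMap q)
      (LinearMap.ker_eq_bot.2 ((sqrtMap_injective_iff q).2 hq))
  set D := LinearMap.range (sqrtMap (baseChange E q))
  have hD : ∀ e : _ → E, ∑ j, e j • SqrtExt.map F E (ρ j) ∈ D := fun e =>
    ⟨∑ j, e j ⊗ₜ w j, by
      rw [map_sum]
      exact Finset.sum_congr rfl fun j _ => sqrtMap_baseChange_tmul E q _ _⟩
  let c := (w.baseChange E).equivFun
  have hc : ∀ z, sqrtMap (baseChange E q) z = ∑ j, c z j • SqrtExt.map F E (ρ j) :=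
    sqrtMap_baseChange_eq_sum E w q
  obtain ⟨U, hU, hUmem⟩ := exists_submodule_of_derivation (sqrtMap (baseChange E q)) c
    (fun j => SqrtExt.map F E (ρ j)) hc δ hδadd hδmul (by
      intro z hz hz0
      rw [hc] at hz
      -- Independence over $K$ is used twice: first the derivatives of the coordinates vanish, so
      -- the coordinates lie in $K$; then the coordinates themselves vanish.
      have h1 : ∀ j, δ (c z j) = 0 := h.eq_zero_of_sum_eq_zero hρ _ (fun j => hδK _) hz0
      have h2 : ∀ j, c z j ∈ base F x := by
        intro j
        obtain ⟨α, hα, β, hβ, hj⟩ := h.exists_decomposition (c z j)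
        have h3 := h1 j
        rw [hj, hδ α hα β hβ] at h3
        rwa [hj, h3, zero_mul, add_zero]
      exact c.map_eq_zero_iff.1 (funext (h.eq_zero_of_sum_eq_zero hρ _ h2 hz)))
  have hb : SqrtExt.map F E (root b₁) ≠ 0 := by
    rw [map_ne_zero, map_ne_zero]
    exact h.ne_zero
  have hrange : ∀ u ∈ U, u ∈ D ∧ ∀ i, ∃ d ∈ D,
      SqrtExt.map F E (root (b i)) * u = SqrtExt.map F E (root b₁) * d := by
    intro u hu
    obtain ⟨z, hz, rfl⟩ := hUmem u hu
    refine ⟨hD _, fun i => ?_⟩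
    rw [hc] at hz
    choose α hα hβ using fun j => h.exists_decomposition (c z j)
    choose β hβ hj using hβ
    -- Scaling the isotropic vector by `d * d'` makes its coordinates polynomial in the $x_i$ and
    -- $y$, as the differentiation argument requires.
    obtain ⟨d, f, hd, hf⟩ := exists_common_denominator α hα
    obtain ⟨d', g, hd', hg⟩ := exists_common_denominator β hβ
    have h1 : ∀ j, MvPolynomial.aeval x (d * d') * c z j = MvPolynomial.aeval x (d' * f j) +
        MvPolynomial.aeval x (d * g j) * y := by
      intro j
      rw [hj, map_mul, map_mul, map_mul, ← hf, ← hg]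
      ring
    obtain ⟨e, he⟩ := h.root_mul_sum_mem ρ (fun j => d' * f j) (fun j => d * g j) (by
      rw [← smul_zero (MvPolynomial.aeval x (d * d')), ← hz, Finset.smul_sum]
      refine Finset.sum_congr rfl fun j _ => ?_
      rw [← h1, mul_smul]) i
    have hdd : MvPolynomial.aeval x (d * d') ≠ 0 := by
      rw [map_mul]; exact mul_ne_zero hd hd'
    refine ⟨(MvPolynomial.aeval x (d * d'))⁻¹ • ∑ j, e j • SqrtExt.map F E (ρ j),
      D.smul_mem _ (hD e), ?_⟩
    rw [mul_smul_comm, ← he, ← mul_smul_comm]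
    congr 1
    rw [eq_inv_smul_iff₀ hdd]
    rw [Finset.smul_sum]
    refine Finset.sum_congr rfl fun j _ => ?_
    rw [hj, hδ _ (hα j) _ (hβ j), ← mul_smul, map_mul, map_mul, ← hg]
    congr 1
    ring
  -- So far $\sqrt{b_i}\,u \in \sqrt{b_1}\,D$ and $u \in D$. Dividing $U$ by $\sqrt{b_1}$ treats all
  -- coefficients alike.
  let μ : SqrtExt E →ₗ[E] SqrtExt E := LinearMap.mulLeft E (SqrtExt.map F E (root b₁))⁻¹
  have hμ : Function.Injective μ := mul_right_injective₀ (inv_ne_zero hb)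
  refine ⟨U.map μ, ?_, ?_⟩
  · rw [← (Submodule.equivMapOfInjective μ hμ U).finrank_eq, hU, isotropyIndex, ← ker_sqrtMap]
  · rintro _ ⟨u, hu, rfl⟩
    obtain ⟨h1, h2⟩ := hrange u hu
    have h3 : SqrtExt.map F E (root b₁) * μ u ∈ D := by
      change _ * (_⁻¹ * _) ∈ D
      rwa [mul_inv_cancel_left₀ hb]
    have h4 : ∀ i, SqrtExt.map F E (root (b i)) * μ u ∈ D := by
      intro i
      obtain ⟨d, hd, hd'⟩ := h2 i
      change _ * (_⁻¹ * _) ∈ D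
      rwa [mul_left_comm, hd', inv_mul_cancel_left₀ hb]
    refine ⟨?_, h3, h4⟩
    -- The remaining coefficient $\sqrt{b_0}$ is an $E$-combination of $\sqrt{b_1}$ and the
    -- $\sqrt{b_i}$.
    have h5 := eq_sub_of_add_eq h.root_mul_coordinate.symm
    rw [h5, sub_mul, Finset.sum_mul]
    refine sub_mem ?_ (sum_mem fun i _ => ?_)
    · rw [smul_mul_assoc]; exact D.smul_mem _ h3
    · rw [smul_mul_assoc]; exact D.smul_mem _ (h4 i)

end IsQuadricFunctionField

/-! ### The norm field as a subfield of $F^{1/2}$. -/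

section NormField

variable {F : Type*} [Field F] [CharP F 2] {V : Type*} [AddCommGroup V] [Module F V]

theorem sq_mem_normField {p : QuasilinearForm F V} {v : V} (hv : p v ≠ 0) (a : F) :
    a ^ 2 ∈ normField p := by
  by_cases ha : a = 0
  · rw [ha, zero_pow two_ne_zero]
    exact zero_mem _
  · refine Subfield.subset_closure ⟨p (a • v), ⟨_, rfl⟩, p v, ⟨_, rfl⟩, ?_, hv, ?_⟩ <;>
      rw [apply_smul]
    · exact mul_ne_zero (pow_ne_zero 2 ha) hv
    · field_simp

theorem fieldRange_le_normField {p : QuasilinearForm F V} {v : V} (hv : p v ≠ 0) :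
    (frobenius F 2).fieldRange ≤ normField p := by
  rintro _ ⟨a, rfl⟩
  exact sq_mem_normField hv a

/-- The square root of the norm field, an extension of `F` inside `F^{1/2}`. -/
noncomputable def sqrtNormField (p : QuasilinearForm F V) {v : V} (hv : p v ≠ 0) :
    IntermediateField F (SqrtExt F) :=
  { (normField p).map (root (F := F)).toRingHom with
    algebraMap_mem' := fun a => ⟨a ^ 2, sq_mem_normField hv a, rfl⟩ }

theorem finrank_sqrtNormField {p : QuasilinearForm F V} {v : V} (hv : p v ≠ 0) :
    Module.finrank F (sqrtNormField p hv) =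
      Subfield.relfinrank (frobenius F 2).fieldRange (normField p) := by
  rw [Subfield.relfinrank_eq_finrank_of_le (fieldRange_le_normField hv)]
  refine Algebra.finrank_eq_of_equiv_equiv
    (RingEquiv.ofBijective (frobenius F 2).rangeRestrictField
      ⟨(frobenius F 2).rangeRestrictField.injective, ?_⟩)
    { toFun := fun z => ⟨root.symm z, ?_⟩
      invFun := fun z => ⟨root z, ?_⟩
      left_inv := fun _ => rfl
      right_inv := fun _ => rfl
      map_mul' := fun _ _ => rfl
      map_add' := fun _ _ => rfl } ?_
  · rintro ⟨_, a, rfl⟩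
    exact ⟨a, rfl⟩
  · obtain ⟨a, ha, haz⟩ := z.2
    rw [← haz]
    exact ha
  · exact ⟨z, z.2, rfl⟩
  · ext a
    rfl

end NormField

/-! ### Dimension count and stability under the norm field. -/

namespace IsQuadricFunctionField

variable {F E σ : Type*} [Field F] [CharP F 2] [Field E] [CharP E 2] [Algebra F E] [Fintype σ]
variable {b₀ b₁ : F} {b : σ → F} {x : σ → E} {y : E}
variable {V : Type*} [AddCommGroup V] [Module F V]
variable {W : Type*} [AddCommGroup W] [Module F W]

/-- At most half of the dimension of an anisotropic form is lost over the function field of a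
quadric. -/
theorem isotropyIndex_le_finrank_range [FiniteDimensional F W]
    (h : IsQuadricFunctionField b₀ b₁ b x y) (q : QuasilinearForm F W) (hq : Anisotropic q) :
    isotropyIndex (baseChange E q) ≤
      Module.finrank E (LinearMap.range (sqrtMap (baseChange E q))) := by
  obtain ⟨U, hU, hmem⟩ := h.exists_submodule_mul_mem q hq
  have hb : SqrtExt.map F E (root b₁) ≠ 0 := by
    rw [map_ne_zero, map_ne_zero]
    exact h.ne_zero
  let μ : SqrtExt E →ₗ[E] SqrtExt E := LinearMap.mulLeft E (SqrtExt.map F E (root b₁))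
  have hμ : Function.Injective μ := mul_right_injective₀ hb
  rw [← hU, (Submodule.equivMapOfInjective μ hμ U).finrank_eq]
  refine Submodule.finrank_mono ?_
  rintro _ ⟨u, hu, rfl⟩
  exact (hmem u hu).2.1

/-- The norm field of a form loses at most one half of its degree over the function field of a
quadric. -/
theorem exists_submodule_of_normField (h : IsQuadricFunctionField b₀ b₁ b x y)
    {p : QuasilinearForm F V} {v : V} (hv : p v ≠ 0) :
    ∃ T : Submodule E (SqrtExt E), 2 ^ (lndeg p - 1) ≤ Module.finrank E T ∧
      ∀ S : IntermediateField E (SqrtExt E),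
        (∀ a ∈ normField p, SqrtExt.map F E (root a) ∈ S) → ∀ t ∈ T, t ∈ S := by
  have hlog : lndeg p = Nat.log 2 (Module.finrank F (sqrtNormField p hv)) := by
    rw [finrank_sqrtNormField, lndeg]
  set N := sqrtNormField p hv
  -- For infinite degree both `Module.finrank` and `Nat.log` give the default 0, and a line
  -- suffices.
  by_cases h0 : Module.finrank F N = 0
  · refine ⟨Submodule.span E {1}, ?_, fun S _ t ht => ?_⟩
    · rw [hlog, h0, finrank_span_singleton one_ne_zero]
      simp
    · obtain ⟨c, rfl⟩ := Submodule.mem_span_singleton.1 ht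
      exact S.smul_mem S.one_mem
  · have : FiniteDimensional F N := Module.finite_of_finrank_pos (Nat.pos_of_ne_zero h0)
    -- The anisotropic form whose values are the elements of the norm field. It keeps at least half
    -- of its dimension over $E$.
    let n : QuasilinearForm F N := ofLinearMap N.val.toLinearMap
    have hn : Function.Injective (sqrtMap n) := Subtype.val_injective
    have h1 := isotropyIndex_add_finrank_range (baseChange E n)
    have h2 := h.isotropyIndex_le_finrank_range n ((sqrtMap_injective_iff n).1 hn)
    rw [dim, Module.finrank_baseChange] at h1
    refine ⟨LinearMap.range (sqrtMap (baseChange E n)), ?_, fun S hS t ht => ?_⟩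
    · have h3 : 2 ^ lndeg p ≤ Module.finrank F N := by
        rw [hlog]; exact Nat.pow_log_le_self 2 h0
      rcases hl : lndeg p with _ | l
      · simp only [zero_tsub, pow_zero]
        omega
      · rw [hl, pow_succ] at h3
        simp only [add_tsub_cancel_right]
        omega
    · rw [range_baseChange_eq_span] at ht
      refine (Submodule.span_le (p := Subalgebra.toSubmodule S.toSubalgebra)).2 ?_ ht
      rintro _ ⟨z, rfl⟩
      obtain ⟨a, ha, haz⟩ := z.2
      change SqrtExt.map F E (z : SqrtExt F) ∈ S
      rw [← haz]
      exact hS a ha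

/-- Over the function field of a quadric `p`, a form `q` whose isotropy index is large in the
sense of the divisibility index of the anisotropic part of `p` has a subform of dimension equal to
the isotropy index of `q` whose values are stable under the norm field of `p`. -/
theorem exists_stable_submodule [FiniteDimensional F W]
    (h : IsQuadricFunctionField b₀ b₁ b x y) {p : QuasilinearForm F V}
    (hp : Anisotropic p)
    (hpb : ∀ v, sqrtMap p v ∈ Submodule.span F ({root b₀, root b₁} ∪ Set.range fun i => root (b i)))
    {v₀ : V} (hv₀ : v₀ ≠ 0)
    (q : QuasilinearForm F W) (hq : Anisotropic q) {d ε : ℕ}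
    (P : IntermediateField E (SqrtExt E)) (hP : Module.finrank E P = 2 ^ d)
    (hPB : ∀ t ∈ P, ∀ z ∈ LinearMap.range (sqrtMap (baseChange E p)),
      t * z ∈ LinearMap.range (sqrtMap (baseChange E p)))
    (hε : ε ≤ 2 ^ d) (hdvd : 2 ^ d ∣ isotropyIndex (baseChange E q) + ε)
    (hlt : dim q < 2 * isotropyIndex (baseChange E q) + ε) :
    ∃ R T : Submodule E (SqrtExt E), R ≤ LinearMap.range (sqrtMap (baseChange E q)) ∧
      Module.finrank E R = isotropyIndex (baseChange E q) ∧
      2 ^ (lndeg p - 1) ≤ Module.finrank E T ∧ ∀ t ∈ T, ∀ r ∈ R, t * r ∈ R := by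
  obtain ⟨U, hU, hmem⟩ := h.exists_submodule_mul_mem q hq
  set D := LinearMap.range (sqrtMap (baseChange E q))
  set B := LinearMap.range (sqrtMap (baseChange E p)) with hB
  let m : V → SqrtExt E := fun v => SqrtExt.map F E (sqrtMap p v)
  have hm0 : ∀ v, v ≠ 0 → m v ≠ 0 := by
    intro v hv
    rw [Ne, map_eq_zero, sqrtMap_apply, map_eq_zero_iff _ root.injective]
    exact fun h => hv (hp v h)
  have hmB : ∀ v, m v ∈ B := by
    intro v
    rw [hB, range_baseChange_eq_span]
    exact Submodule.subset_span ⟨v, rfl⟩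
  have hmD : ∀ v, ∀ u ∈ U, m v * u ∈ D := by
    intro v u hu
    obtain ⟨h0, h1, h2⟩ := hmem u hu
    have hv := hpb v
    change SqrtExt.map F E (sqrtMap p v) * u ∈ D
    generalize sqrtMap p v = z at hv
    induction hv using Submodule.span_induction with
    | mem z hz =>
      rcases hz with (rfl | rfl) | ⟨i, rfl⟩
      · exact h0
      · exact h1
      · exact h2 i
    | zero => rw [map_zero, zero_mul]; exact D.zero_mem
    | add z z' _ _ hz hz' => rw [map_add, add_mul]; exact D.add_mem hz hz'
    | smul a z _ hz => rw [SqrtExt.map_smul_eq, smul_mul_assoc]; exact D.smul_mem _ hz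
  have hBU : B * U ≤ D := by
    rw [hB, range_baseChange_eq_span, Submodule.mul_le]
    intro z hz u hu
    induction hz using Submodule.span_induction with
    | mem z hz => obtain ⟨v, rfl⟩ := hz; exact hmD v u hu
    | zero => rw [zero_mul]; exact D.zero_mem
    | add z z' _ _ hz hz' => rw [add_mul]; exact D.add_mem hz hz'
    | smul a z _ hz => rw [smul_mul_assoc]; exact D.smul_mem _ hz
  have hfin : FiniteDimensional E (B * U : Submodule E (SqrtExt E)) :=
    Submodule.finiteDimensional_of_le hBU
  have hμinj : ∀ v, v ≠ 0 → Function.Injective (LinearMap.mulLeft E (m v)) :=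
    fun v hv => mul_right_injective₀ (hm0 v hv)
  have hle : ∀ v, U.map (LinearMap.mulLeft E (m v)) ≤ B * U := by
    rintro v _ ⟨u, hu, rfl⟩
    exact Submodule.mul_mem_mul (hmB v) hu
  have hfr : ∀ v, v ≠ 0 → Module.finrank E (U.map (LinearMap.mulLeft E (m v))) =
      isotropyIndex (baseChange E q) := by
    intro v hv
    rw [← (Submodule.equivMapOfInjective _ (hμinj v hv) U).finrank_eq, hU]
  have hPstab : ∀ t ∈ P, ∀ r ∈ B * U, t * r ∈ B * U := by
    intro t ht r hr
    induction hr using Submodule.mul_induction_on' with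
    | mem_mul_mem z hz u hu =>
      rw [← mul_assoc]
      exact Submodule.mul_mem_mul (hPB t ht z hz) hu
    | add r _ r' _ hr hr' => rw [mul_add]; exact Submodule.add_mem _ hr hr'
  have hR : Module.finrank E (B * U : Submodule E (SqrtExt E)) =
      isotropyIndex (baseChange E q) := by
    have h1 : 2 ^ d ∣ Module.finrank E (B * U : Submodule E (SqrtExt E)) := by
      rw [← hP]
      exact ⟨_, (finrank_mul_finrank_extendSubmodule P _ hPstab).symm⟩
    have h2 : isotropyIndex (baseChange E q) ≤
        Module.finrank E (B * U : Submodule E (SqrtExt E)) := by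
      rw [← hfr v₀ hv₀]
      exact Submodule.finrank_mono (hle v₀)
    have h3 : Module.finrank E (B * U : Submodule E (SqrtExt E)) <
        isotropyIndex (baseChange E q) + ε := by
      have h4 := Submodule.finrank_mono hBU
      have h5 : isotropyIndex (baseChange E q) + Module.finrank E D = dim (baseChange E q) :=
        isotropyIndex_add_finrank_range (baseChange E q)
      have h6 : dim (baseChange E q) = dim q := Module.finrank_baseChange
      omega
    -- The difference is a positive multiple of $2^d$, hence at least $2^d \ge \epsilon$. So $\dim
    -- BU \le \mathfrak{i}_0$.
    have h4 : 2 ^ d ∣ isotropyIndex (baseChange E q) + ε -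
        Module.finrank E (B * U : Submodule E (SqrtExt E)) := Nat.dvd_sub hdvd h1
    have h5 := Nat.le_of_dvd (by omega) h4
    omega
  have hmap : ∀ v, v ≠ 0 → U.map (LinearMap.mulLeft E (m v)) = B * U := fun v hv =>
    Submodule.eq_of_le_of_finrank_eq (hle v) (by rw [hfr v hv, hR])
  have hpv₀ : p v₀ ≠ 0 := fun h => hv₀ (hp v₀ h)
  obtain ⟨T, hT, hTS⟩ := h.exists_submodule_of_normField hpv₀
  refine ⟨B * U, T, hBU, hR, hT, hTS (stabilizer (B * U)) ?_⟩
  intro a ha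
  -- The elements of $F$ whose roots stabilize $BU$ form a subfield, so it is enough to treat the
  -- generating ratios $p(v)/p(w)$. Division by $\sqrt{p(w)}$ carries $BU$ to $U$, and
  -- multiplication by $\sqrt{p(v)}$ carries $U$ back.
  have hcl : normField p ≤ (stabilizer (B * U)).toSubfield.comap
      ((SqrtExt.map F E).comp (root (F := F)).toRingHom) := by
    rw [normField, Subfield.closure_le]
    rintro _ ⟨_, ⟨v, rfl⟩, _, ⟨w, rfl⟩, hv, hw, rfl⟩
    have hw0 : w ≠ 0 := by rintro rfl; exact hw (map_zero p)
    have hv0 : v ≠ 0 := by rintro rfl; exact hv (map_zero p)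
    change SqrtExt.map F E (root (p v / p w)) ∈ stabilizer (B * U)
    rw [map_div₀, map_div₀, mem_stabilizer]
    intro r hr
    rw [← hmap w hw0] at hr
    obtain ⟨u, hu, rfl⟩ := hr
    rw [← hmap v hv0]
    refine ⟨u, hu, ?_⟩
    change m v * u = m v / m w * (m w * u)
    have := hm0 w hw0
    field_simp
  exact hcl ha

end IsQuadricFunctionField

/-! ### An affine chart of the quadric. -/

section FunctionField

variable {F : Type*} [Field F] [CharP F 2] {V : Type*} [AddCommGroup V] [Module F V]
variable [FiniteDimensional F V]

theorem aeval_coordinate (p : QuasilinearForm F V)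
    (f : MvPolynomial (Fin (Module.finrank F V)) F) :
    MvPolynomial.aeval (coordinate p) f =
      algebraMap (MvPolynomial (Fin (Module.finrank F V)) F ⧸ coneIdeal p) (AffineFunctionField p)
        (Ideal.Quotient.mk (coneIdeal p) f) := by
  induction f using MvPolynomial.induction_on with
  | C a =>
    rw [MvPolynomial.aeval_C]
    rfl
  | add f g hf hg => rw [map_add, hf, hg, map_add, map_add]
  | mul_X f i hf => rw [map_mul, hf, map_mul, map_mul, MvPolynomial.aeval_X, coordinate]

theorem aeval_coordinate_eq_zero_iff (p : QuasilinearForm F V)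
    (f : MvPolynomial (Fin (Module.finrank F V)) F) :
    MvPolynomial.aeval (coordinate p) f = 0 ↔ f ∈ coneIdeal p := by
  rw [aeval_coordinate, map_eq_zero_iff _ (IsFractionRing.injective _ _),
    Ideal.Quotient.eq_zero_iff_mem]

/-- Homogenization of a polynomial with respect to the variable `i`. -/
theorem exists_homogenization {R A B ι : Type*} [Field R] [Field A] [Algebra R A] [CommRing B]
    [Algebra R B] (t : ι → A) (i : ι) (ht : t i ≠ 0) (ψ : MvPolynomial ι R →ₐ[R] B)
    (hψ : ψ (MvPolynomial.X i) = 1) (f : MvPolynomial ι R) :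
    ∃ (N : ℕ) (g : MvPolynomial ι R),
      MvPolynomial.aeval t g = t i ^ N * MvPolynomial.aeval (fun j => t j / t i) f ∧
      ψ g = ψ f := by
  induction f using MvPolynomial.induction_on with
  | C a => exact ⟨0, MvPolynomial.C a, by simp, rfl⟩
  | add f f' hf hf' =>
    obtain ⟨N, g, h1, h2⟩ := hf
    obtain ⟨N', g', h1', h2'⟩ := hf'
    refine ⟨N + N', MvPolynomial.X i ^ N' * g + MvPolynomial.X i ^ N * g', ?_, ?_⟩
    · simp only [map_add, map_mul, map_pow, MvPolynomial.aeval_X, h1, h1']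
      ring
    · rw [map_add, map_add, map_mul, map_mul, map_pow, map_pow, hψ, h2, h2', one_pow, one_pow,
        one_mul, one_mul]
  | mul_X f j hf =>
    obtain ⟨N, g, h1, h2⟩ := hf
    refine ⟨N + 1, g * MvPolynomial.X j, ?_, ?_⟩
    · simp only [map_mul, MvPolynomial.aeval_X, h1]
      field_simp
      ring
    · rw [map_mul, map_mul, h2]

theorem sum_eq_add_add_sum_subtype {ι M : Type*} [Fintype ι] [DecidableEq ι] [AddCommMonoid M]
    {i j : ι} (hij : i ≠ j) (f : ι → M) :
    ∑ k, f k = f i + f j + ∑ k : {k : ι // k ≠ i ∧ k ≠ j}, f k := by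
  rw [← Finset.add_sum_erase _ _ (Finset.mem_univ i),
    ← Finset.add_sum_erase _ _ (Finset.mem_erase.2 ⟨hij.symm, Finset.mem_univ j⟩), add_assoc]
  congr 2
  exact Finset.sum_subtype _ (fun k => by simp [and_comm]) _

section Dehomogenize

variable {ι : Type*} [DecidableEq ι]

/-- Substitution of `1` for the variable `i`, with the variable `j` singled out. -/
noncomputable def dehomogenize (i j : ι) :
    MvPolynomial ι F →ₐ[F] Polynomial (MvPolynomial {k : ι // k ≠ i ∧ k ≠ j} F) :=
  MvPolynomial.aeval fun k => if h : k ≠ i ∧ k ≠ j then Polynomial.C (MvPolynomial.X ⟨k, h⟩)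
    else if k = i then 1 else Polynomial.X

omit [CharP F 2] in
theorem dehomogenize_X_left (i j : ι) : dehomogenize (F := F) i j (MvPolynomial.X i) = 1 := by
  simp [dehomogenize]

omit [CharP F 2] in
theorem dehomogenize_X_right {i j : ι} (h : i ≠ j) :
    dehomogenize (F := F) i j (MvPolynomial.X j) = Polynomial.X := by
  simp [dehomogenize, h.symm]

omit [CharP F 2] in
theorem dehomogenize_X_coe {i j : ι} (k : {k : ι // k ≠ i ∧ k ≠ j}) :
    dehomogenize (F := F) i j (MvPolynomial.X (k : ι)) = Polynomial.C (MvPolynomial.X k) := by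
  simp [dehomogenize, k.2]

omit [CharP F 2] in
theorem dehomogenize_rename {i j : ι} (f : MvPolynomial {k : ι // k ≠ i ∧ k ≠ j} F) :
    dehomogenize i j (MvPolynomial.rename (↑) f) = Polynomial.C f := by
  induction f using MvPolynomial.induction_on with
  | C a =>
    rw [MvPolynomial.rename_C, dehomogenize, MvPolynomial.aeval_C]
    rfl
  | add f g hf hg => rw [map_add, map_add, hf, hg, map_add]
  | mul_X f k hf =>
    rw [map_mul, map_mul, MvPolynomial.rename_X, hf, dehomogenize_X_coe, map_mul]

end Dehomogenize

variable (p : QuasilinearForm F V)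

theorem natDegree_dehomogenize (hp : Anisotropic p) {i j : Fin (Module.finrank F V)}
    (hij : i ≠ j) : (dehomogenize i j (polynomial p)).natDegree = 2 := by
  set b := Module.finBasis F V
  have h1 : dehomogenize i j (polynomial p) =
      Polynomial.C (MvPolynomial.C (p (b j))) * Polynomial.X ^ 2 +
      Polynomial.C (MvPolynomial.C (p (b i)) +
        ∑ k : {k // k ≠ i ∧ k ≠ j}, MvPolynomial.C (p (b k)) * MvPolynomial.X k ^ 2) := by
    have hC : ∀ a : F, dehomogenize i j (MvPolynomial.C a) =
        Polynomial.C (MvPolynomial.C a) := fun a => by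
      rw [dehomogenize, MvPolynomial.aeval_C]
      rfl
    rw [polynomial, map_sum, sum_eq_add_add_sum_subtype hij]
    simp only [map_mul, map_pow, dehomogenize_X_coe, dehomogenize_X_left,
      dehomogenize_X_right hij, hC, map_add, map_sum, one_pow, mul_one]
    ring
  rw [h1, Polynomial.natDegree_add_C, Polynomial.natDegree_C_mul_X_pow]
  rw [Ne, MvPolynomial.C_eq_zero]
  exact fun h => b.ne_zero j (hp _ h)

/-- With the variable $i$ set to 1, the equation still has degree 2 in the variable $j$. A multiple
of it of degree at most 1 in that variable must therefore be zero. -/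
theorem dehomogenize_eq_zero (hp : Anisotropic p) (hdp : 2 ≤ dim p)
    {i j : Fin (Module.finrank F V)} (hij : i ≠ j) {f : MvPolynomial (Fin (Module.finrank F V)) F}
    (hf : MvPolynomial.aeval (coordinate p) f = 0)
    (hdeg : (dehomogenize i j f).natDegree ≤ 1) : dehomogenize i j f = 0 := by
  rw [aeval_coordinate_eq_zero_iff, coneIdeal_eq p hp hdp, Ideal.mem_span_singleton] at hf
  obtain ⟨g, rfl⟩ := hf
  have h2 := natDegree_dehomogenize p hp hij
  rw [map_mul] at hdeg ⊢
  by_contra h0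
  rw [Polynomial.natDegree_mul (left_ne_zero_of_mul h0) (right_ne_zero_of_mul h0)] at hdeg
  omega

theorem coordinate_ne_zero (hp : Anisotropic p) (hdp : 2 ≤ dim p)
    (j : Fin (Module.finrank F V)) : coordinate p j ≠ 0 := by
  intro h0
  have : Nontrivial (Fin (Module.finrank F V)) := Fin.nontrivial_iff_two_le.2 hdp
  obtain ⟨i, hij⟩ := exists_ne j
  have h1 : MvPolynomial.aeval (coordinate p) (MvPolynomial.X j : MvPolynomial _ F) = 0 := by
    rw [MvPolynomial.aeval_X, h0]
  have h2 := dehomogenize_eq_zero p hp hdp hij h1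
    (by rw [dehomogenize_X_right hij, Polynomial.natDegree_X])
  rw [dehomogenize_X_right hij] at h2
  exact Polynomial.X_ne_zero h2

theorem sum_coordinate_sq (hp : Anisotropic p) (hdp : 2 ≤ dim p) :
    ∑ k, algebraMap F (AffineFunctionField p) (p (Module.finBasis F V k)) *
      coordinate p k ^ 2 = 0 := by
  have h : MvPolynomial.aeval (coordinate p) (polynomial p) = 0 := by
    rw [aeval_coordinate_eq_zero_iff, coneIdeal_eq p hp hdp]
    exact Ideal.mem_span_singleton_self _
  rw [← h, polynomial, map_sum]
  refine Finset.sum_congr rfl fun k _ => ?_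
  rw [map_mul, map_pow, MvPolynomial.aeval_C, MvPolynomial.aeval_X]

/-- The inclusion of the function field of the quadric in that of its affine cone. -/
noncomputable def functionFieldVal : FunctionField p →ₐ[F] AffineFunctionField p :=
  (functionSubfield p).val

/-- The quotient of two homogeneous coordinates in the function field of the quadric. -/
noncomputable def coordinateRatio (i j : Fin (Module.finrank F V)) : FunctionField p :=
  (⟨coordinate p i / coordinate p j, IntermediateField.subset_adjoin F _ ⟨i, j, rfl⟩⟩ :
    functionSubfield p)

theorem functionFieldVal_coordinateRatio (i j : Fin (Module.finrank F V)) :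
    functionFieldVal p (coordinateRatio p i j) = coordinate p i / coordinate p j := rfl

theorem map_functionFieldVal_top :
    (⊤ : IntermediateField F (FunctionField p)).map (functionFieldVal p) = functionSubfield p := by
  ext z
  constructor
  · rintro ⟨w, -, rfl⟩
    exact Subtype.property (p := (· ∈ functionSubfield p)) w
  · intro hz
    exact ⟨(⟨z, hz⟩ : functionSubfield p), trivial, rfl⟩

/-- In the chart where coordinate $i$ is nonzero, $T_j/T_i$ plays the role of $y$ and the other
ratios $T_k/T_i$ that of the $x_k$. The independence of $1, y$ holds since a relation linear in $y$
homogenizes to a multiple of the equation of degree at most 1 in $T_j$. -/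
theorem isQuadricFunctionField (hp : Anisotropic p) (hdp : 2 ≤ dim p)
    {i j : Fin (Module.finrank F V)} (hij : i ≠ j) :
    IsQuadricFunctionField (E := FunctionField p) (p (Module.finBasis F V i))
      (p (Module.finBasis F V j))
      (fun k : {k // k ≠ i ∧ k ≠ j} => p (Module.finBasis F V k))
      (fun k => coordinateRatio p k i) (coordinateRatio p j i) where
  ne_zero h := (Module.finBasis F V).ne_zero j (hp _ h)
  equation := by
    apply (functionFieldVal p).injective
    change functionFieldVal p _ = functionFieldVal p 0
    have hi := coordinate_ne_zero p hp hdp i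
    have h := sum_coordinate_sq p hp hdp
    rw [sum_eq_add_add_sum_subtype hij] at h
    simp only [map_add, map_mul, map_pow, map_sum, AlgHom.commutes,
      functionFieldVal_coordinateRatio, map_zero]
    have h2 := congrArg (fun z => z / coordinate p i ^ 2) h
    simp only [zero_div, add_div, Finset.sum_div] at h2
    rw [← h2]
    congr 1
    · congr 1
      · rw [mul_div_cancel_right₀ _ (pow_ne_zero 2 hi)]
      · rw [div_pow, mul_div_assoc]
    · exact Finset.sum_congr rfl fun k _ => by rw [div_pow, mul_div_assoc]
  adjoin_eq_top := by
    have hi := coordinate_ne_zero p hp hdp i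
    apply IntermediateField.map_injective (functionFieldVal p)
    rw [map_functionFieldVal_top]
    refine le_antisymm ?_ ?_
    · rw [← map_functionFieldVal_top]
      exact IntermediateField.map_mono _ le_top
    · rw [IntermediateField.adjoin_map, functionSubfield, IntermediateField.adjoin_le_iff]
      have key : ∀ k, coordinate p k / coordinate p i ∈ IntermediateField.adjoin F
          (functionFieldVal p '' (insert (coordinateRatio p j i)
            (Set.range fun k : {k // k ≠ i ∧ k ≠ j} => coordinateRatio p k i))) := by
        intro k
        by_cases hki : k = i
        · rw [hki, div_self hi]
          exact one_mem _
        · refine IntermediateField.subset_adjoin _ _ ⟨coordinateRatio p k i, ?_, rfl⟩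
          by_cases hkj : k = j
          · rw [hkj]
            exact Set.mem_insert _ _
          · exact Set.mem_insert_of_mem _ ⟨⟨k, hki, hkj⟩, rfl⟩
      rintro _ ⟨k, l, rfl⟩
      rw [← div_div_div_cancel_right₀ hi]
      exact div_mem (key k) (key l)
  indep f g h := by
    have hi := coordinate_ne_zero p hp hdp i
    let H : MvPolynomial (Fin (Module.finrank F V)) F :=
      MvPolynomial.rename (↑) f + MvPolynomial.rename (↑) g * MvPolynomial.X j
    have hψ : dehomogenize i j H = Polynomial.C f + Polynomial.C g * Polynomial.X := by
      rw [map_add, map_mul, dehomogenize_rename, dehomogenize_rename, dehomogenize_X_right hij]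
    have hH : MvPolynomial.aeval (fun k => coordinate p k / coordinate p i) H = 0 := by
      have h2 := congrArg (functionFieldVal p) h
      rw [map_add, map_mul, map_zero, MvPolynomial.comp_aeval_apply,
        MvPolynomial.comp_aeval_apply] at h2
      rw [← h2, map_add, map_mul, MvPolynomial.aeval_rename, MvPolynomial.aeval_rename,
        MvPolynomial.aeval_X]
      rfl
    obtain ⟨N, G, hG, hGψ⟩ := exists_homogenization (coordinate p) i hi (dehomogenize i j)
      (dehomogenize_X_left i j) H
    rw [hH, mul_zero] at hG
    have h0 := dehomogenize_eq_zero p hp hdp hij hG (by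
      rw [hGψ, hψ, add_comm]
      exact Polynomial.natDegree_linear_le)
    rw [hGψ, hψ] at h0
    have c0 := congrArg (fun P => Polynomial.coeff P 0) h0
    have c1 := congrArg (fun P => Polynomial.coeff P 1) h0
    simp at c0 c1
    exact ⟨c0, c1⟩

theorem sqrtMap_mem_span (i j : Fin (Module.finrank F V)) (v : V) :
    sqrtMap p v ∈ Submodule.span F ({root (p (Module.finBasis F V i)),
      root (p (Module.finBasis F V j))} ∪
      Set.range fun k : {k // k ≠ i ∧ k ≠ j} => root (p (Module.finBasis F V k))) := by
  rw [← (Module.finBasis F V).sum_repr v, map_sum]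
  refine Submodule.sum_mem _ fun k _ => ?_
  rw [LinearMap.map_smul]
  refine Submodule.smul_mem _ _ (Submodule.subset_span ?_)
  by_cases hki : k = i
  · exact Or.inl (Or.inl (by rw [hki]; rfl))
  · by_cases hkj : k = j
    · exact Or.inl (Or.inr (by rw [hkj]; rfl))
    · exact Or.inr ⟨⟨k, hki, hkj⟩, rfl⟩

end FunctionField

/-! ### Isometric forms have isomorphic function fields. -/

section Isometry

variable {F : Type*} [Field F] [CharP F 2] {V : Type*} [AddCommGroup V] [Module F V]
variable [FiniteDimensional F V] {W : Type*} [AddCommGroup W] [Module F W] [FiniteDimensional F W]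

/-- The linear substitution of polynomial rings given by a linear map. -/
noncomputable def substitution (e : V →ₗ[F] W) :
    MvPolynomial (Fin (Module.finrank F W)) F →ₐ[F] MvPolynomial (Fin (Module.finrank F V)) F :=
  MvPolynomial.aeval fun i => ∑ j,
    MvPolynomial.C ((Module.finBasis F W).repr (e (Module.finBasis F V j)) i) * MvPolynomial.X j

omit [CharP F 2] in
theorem substitution_X (e : V →ₗ[F] W) (i : Fin (Module.finrank F W)) :
    substitution e (MvPolynomial.X i) = ∑ j,
      MvPolynomial.C ((Module.finBasis F W).repr (e (Module.finBasis F V j)) i) *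
        MvPolynomial.X j := by
  rw [substitution, MvPolynomial.aeval_X]

omit [CharP F 2] in
theorem substitution_comp_substitution (e : V →ₗ[F] W) (f : W →ₗ[F] V) (h : ∀ v, f (e v) = v) :
    (substitution e).comp (substitution f) = AlgHom.id F _ := by
  classical
  ext1 i
  rw [AlgHom.comp_apply, substitution_X, map_sum, AlgHom.id_apply]
  have hC : ∀ a : F, substitution e (MvPolynomial.C a) = MvPolynomial.C a := fun a => by
    rw [substitution, MvPolynomial.aeval_C, MvPolynomial.algebraMap_eq]
  simp only [map_mul, substitution_X, hC, Finset.mul_sum]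
  rw [Finset.sum_comm]
  -- The coefficients are the entries of the matrix of $f \circ e = \mathrm{id}$.
  have key : ∀ k, ∑ j, MvPolynomial.C ((Module.finBasis F V).repr (f (Module.finBasis F W j)) i) *
      (MvPolynomial.C ((Module.finBasis F W).repr (e (Module.finBasis F V k)) j) *
        MvPolynomial.X k) =
      (if k = i then MvPolynomial.X i else 0 : MvPolynomial (Fin (Module.finrank F V)) F) := by
    intro k
    have h1 : ∑ j, (Module.finBasis F V).repr (f (Module.finBasis F W j)) i *
        (Module.finBasis F W).repr (e (Module.finBasis F V k)) j = if k = i then 1 else 0 := by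
      have h2 := h (Module.finBasis F V k)
      rw [← (Module.finBasis F W).sum_repr (e (Module.finBasis F V k)), map_sum] at h2
      have h3 := congrArg (fun v => (Module.finBasis F V).repr v i) h2
      simp only [map_sum, map_smul, Finsupp.coe_finsetSum, Finset.sum_apply, Finsupp.smul_apply,
        smul_eq_mul, Module.Basis.repr_self, Finsupp.single_apply] at h3
      rw [← h3]
      exact Finset.sum_congr rfl fun j _ => mul_comm _ _
    simp only [← mul_assoc, ← map_mul]
    rw [← Finset.sum_mul, ← map_sum, h1]
    split_ifs with hk
    · rw [hk, map_one, one_mul]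
    · rw [map_zero, zero_mul]
  rw [Finset.sum_congr rfl fun k _ => key k]
  simp

theorem substitution_polynomial (e : V →ₗ[F] W) {p : QuasilinearForm F V} {q : QuasilinearForm F W}
    (h : ∀ v, q (e v) = p v) : substitution e (polynomial q) = polynomial p := by
  have hC : ∀ a : F, substitution e (MvPolynomial.C a) = MvPolynomial.C a := fun a => by
    rw [substitution, MvPolynomial.aeval_C, MvPolynomial.algebraMap_eq]
  simp only [polynomial, map_sum, map_mul, map_pow, hC, substitution_X]
  have h1 : ∀ i, (∑ j, MvPolynomial.C ((Module.finBasis F W).repr (e (Module.finBasis F V j)) i) *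
      MvPolynomial.X j : MvPolynomial (Fin (Module.finrank F V)) F) ^ 2 =
      ∑ j, MvPolynomial.C ((Module.finBasis F W).repr (e (Module.finBasis F V j)) i ^ 2) *
        MvPolynomial.X j ^ 2 := by
    intro i
    rw [sum_pow_char 2]
    exact Finset.sum_congr rfl fun j _ => by rw [mul_pow, map_pow]
  simp only [h1, Finset.mul_sum]
  rw [Finset.sum_comm]
  refine Finset.sum_congr rfl fun j _ => ?_
  have h2 : p (Module.finBasis F V j) = ∑ i,
      (Module.finBasis F W).repr (e (Module.finBasis F V j)) i ^ 2 * q (Module.finBasis F W i) := by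
    rw [← h]
    conv_lhs => rw [← (Module.finBasis F W).sum_repr (e (Module.finBasis F V j)), map_sum]
    exact Finset.sum_congr rfl fun i _ => apply_smul q _ _
  rw [h2, map_sum, Finset.sum_mul]
  refine Finset.sum_congr rfl fun i _ => ?_
  rw [map_mul]
  ring

/-- An isometry induces an isomorphism of polynomial rings. -/
noncomputable def substitutionEquiv (e : V ≃ₗ[F] W) :
    MvPolynomial (Fin (Module.finrank F W)) F ≃ₐ[F] MvPolynomial (Fin (Module.finrank F V)) F :=
  AlgEquiv.ofAlgHom (substitution e.toLinearMap) (substitution e.symm.toLinearMap)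
    (substitution_comp_substitution _ _ fun v => e.symm_apply_apply v)
    (substitution_comp_substitution _ _ fun w => e.apply_symm_apply w)

theorem exists_affineFunctionField_equiv {p : QuasilinearForm F V} {q : QuasilinearForm F W}
    (e : V ≃ₗ[F] W) (he : ∀ v, q (e v) = p v) (hp : Anisotropic p) (hq : Anisotropic q)
    (hdp : 2 ≤ dim p) (hdq : 2 ≤ dim q) :
    ∃ Φ : AffineFunctionField q ≃ₐ[F] AffineFunctionField p, ∀ f,
      Φ (MvPolynomial.aeval (coordinate q) f) =
        MvPolynomial.aeval (coordinate p) (substitutionEquiv e f) := by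
  have hI : coneIdeal p = (coneIdeal q).map (substitutionEquiv e : _ →+* _) := by
    rw [coneIdeal_eq p hp hdp, coneIdeal_eq q hq hdq, Ideal.map_span, Set.image_singleton]
    congr 2
    exact (substitution_polynomial e.toLinearMap he).symm
  refine ⟨IsFractionRing.algEquivOfAlgEquiv
    (Ideal.quotientEquivAlg (coneIdeal q) (coneIdeal p) (substitutionEquiv e) hI), fun f => ?_⟩
  rw [aeval_coordinate, aeval_coordinate, IsFractionRing.algEquivOfAlgEquiv_algebraMap]
  rfl

theorem map_functionSubfield_le {p : QuasilinearForm F V} {q : QuasilinearForm F W}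
    (hp : Anisotropic p) (hdp : 2 ≤ dim p)
    (Φ : AffineFunctionField q →ₐ[F] AffineFunctionField p)
    (c : Fin (Module.finrank F W) → Fin (Module.finrank F V) → F)
    (hΦ : ∀ i, Φ (coordinate q i) = ∑ j, algebraMap F _ (c i j) * coordinate p j) :
    (functionSubfield q).map Φ ≤ functionSubfield p := by
  rw [functionSubfield, IntermediateField.adjoin_map, IntermediateField.adjoin_le_iff]
  rintro _ ⟨_, ⟨i, k, rfl⟩, rfl⟩
  have hpos : 0 < Module.finrank F V := lt_of_lt_of_le two_pos hdp
  -- A linear form in the coordinates is not in the function field of the projective quadric, but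
  -- its quotient by one fixed coordinate is.
  let o : Fin (Module.finrank F V) := ⟨0, hpos⟩
  have ho := coordinate_ne_zero p hp hdp o
  have key : ∀ i, Φ (coordinate q i) / coordinate p o ∈ functionSubfield p := by
    intro i
    rw [hΦ, Finset.sum_div]
    refine sum_mem fun j _ => ?_
    rw [mul_div_assoc]
    exact mul_mem (algebraMap_mem _ _) (IntermediateField.subset_adjoin _ _ ⟨j, o, rfl⟩)
  change Φ _ ∈ functionSubfield p
  rw [map_div₀, ← div_div_div_cancel_right₀ ho]
  exact div_mem (key i) (key k)

/-- Isometric forms have isomorphic function fields. -/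
theorem Isometric.nonempty_functionField_equiv {p : QuasilinearForm F V} {q : QuasilinearForm F W}
    (h : Isometric p q) (hp : Anisotropic p) (hq : Anisotropic q)
    (hdp : 2 ≤ dim p) (hdq : 2 ≤ dim q) :
    Nonempty (FunctionField p ≃ₐ[F] FunctionField q) := by
  obtain ⟨e, he⟩ := h
  obtain ⟨Φ, hΦ⟩ := exists_affineFunctionField_equiv e he hp hq hdp hdq
  have hsymm : ∀ f, Φ.symm (MvPolynomial.aeval (coordinate p) f) =
      MvPolynomial.aeval (coordinate q) ((substitutionEquiv e).symm f) := by
    intro f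
    rw [AlgEquiv.symm_apply_eq, hΦ, AlgEquiv.apply_symm_apply]
  have h1 : (functionSubfield q).map Φ.toAlgHom ≤ functionSubfield p := by
    refine map_functionSubfield_le hp hdp Φ.toAlgHom
      (fun i j => (Module.finBasis F W).repr (e (Module.finBasis F V j)) i) fun i => ?_
    have := hΦ (MvPolynomial.X i)
    rw [MvPolynomial.aeval_X] at this
    refine this.trans ?_
    change MvPolynomial.aeval (coordinate p) (substitution e.toLinearMap (MvPolynomial.X i)) = _
    simp [substitution_X]
  have h2 : (functionSubfield p).map Φ.symm.toAlgHom ≤ functionSubfield q := by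
    refine map_functionSubfield_le hq hdq Φ.symm.toAlgHom
      (fun i j => (Module.finBasis F V).repr (e.symm (Module.finBasis F W j)) i) fun i => ?_
    have := hsymm (MvPolynomial.X i)
    rw [MvPolynomial.aeval_X] at this
    refine this.trans ?_
    change MvPolynomial.aeval (coordinate q) (substitution e.symm.toLinearMap (MvPolynomial.X i)) = _
    simp [substitution_X]
  have h3 : (functionSubfield p).map Φ.symm.toAlgHom = functionSubfield q := by
    refine le_antisymm h2 fun z hz => ⟨Φ z, h1 ⟨z, hz, rfl⟩, Φ.symm_apply_apply z⟩
  exact ⟨(IntermediateField.intermediateFieldMap Φ.symm (functionSubfield p)).trans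
    (IntermediateField.equivOfEq h3)⟩

end Isometry

/-! ### Transport along an isomorphism of extensions. -/

section Transport

variable {F : Type*} [Field F] [CharP F 2] {E E' : Type*} [Field E] [CharP E 2] [Algebra F E]
  [Field E'] [CharP E' 2] [Algebra F E']

/-- The isomorphism `E^{1/2} ≃ E'^{1/2}` induced by an isomorphism `E ≃ E'`. -/
noncomputable def sqrtEquiv (τ : E ≃ₐ[F] E') : SqrtExt E ≃+* SqrtExt E' :=
  (root (F := E)).symm.trans (τ.toRingEquiv.trans (root (F := E')))

omit [CharP F 2] in
theorem sqrtEquiv_smul (τ : E ≃ₐ[F] E') (a : E) (z : SqrtExt E) :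
    sqrtEquiv τ (a • z) = τ a • sqrtEquiv τ z := by
  rw [Algebra.smul_def, map_mul, Algebra.smul_def]
  congr 1
  exact map_pow τ a 2

/-- The image of a subspace of `E^{1/2}` under an isomorphism `E ≃ E'`. -/
noncomputable def mapSubmodule (τ : E ≃ₐ[F] E') (R : Submodule E (SqrtExt E)) :
    Submodule E' (SqrtExt E') where
  carrier := {z | (sqrtEquiv τ).symm z ∈ R}
  add_mem' := fun {y z} hy hz => by
    simp only [Set.mem_ofPred_eq, map_add] at *
    exact R.add_mem hy hz
  zero_mem' := by simp
  smul_mem' := fun a z hz => by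
    have h : (sqrtEquiv τ).symm (a • z) = τ.symm a • (sqrtEquiv τ).symm z := by
      rw [RingEquiv.symm_apply_eq, sqrtEquiv_smul, AlgEquiv.apply_symm_apply,
        RingEquiv.apply_symm_apply]
    rw [Set.mem_ofPred_eq, h]
    exact R.smul_mem _ hz

omit [CharP F 2] in
theorem mem_mapSubmodule (τ : E ≃ₐ[F] E') (R : Submodule E (SqrtExt E)) (z : SqrtExt E') :
    z ∈ mapSubmodule τ R ↔ (sqrtEquiv τ).symm z ∈ R := Iff.rfl

omit [CharP F 2] in
theorem finrank_mapSubmodule (τ : E ≃ₐ[F] E') (R : Submodule E (SqrtExt E)) :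
    Module.finrank E' (mapSubmodule τ R) = Module.finrank E R := by
  let e : R ≃+ mapSubmodule τ R :=
    { toFun := fun z => ⟨sqrtEquiv τ z, by
        rw [mem_mapSubmodule, RingEquiv.symm_apply_apply]; exact z.2⟩
      invFun := fun z => ⟨(sqrtEquiv τ).symm z, z.2⟩
      left_inv := fun z => Subtype.ext ((sqrtEquiv τ).symm_apply_apply _)
      right_inv := fun z => Subtype.ext ((sqrtEquiv τ).apply_symm_apply _)
      map_add' := fun y z => Subtype.ext (map_add (sqrtEquiv τ) _ _) }
  have h := lift_rank_eq_of_equiv_equiv τ e τ.bijective fun a z =>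
    Subtype.ext (sqrtEquiv_smul τ a z)
  have h2 := congrArg Cardinal.toNat h
  rw [Cardinal.toNat_lift, Cardinal.toNat_lift] at h2
  exact h2.symm

theorem mapSubmodule_range_le {W : Type*} [AddCommGroup W] [Module F W] (τ : E ≃ₐ[F] E')
    (q : QuasilinearForm F W) :
    mapSubmodule τ (LinearMap.range (sqrtMap (baseChange E q))) ≤
      LinearMap.range (sqrtMap (baseChange E' q)) := by
  intro z hz
  rw [mem_mapSubmodule, range_baseChange_eq_span] at hz
  rw [range_baseChange_eq_span, ← (sqrtEquiv τ).apply_symm_apply z]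
  generalize (sqrtEquiv τ).symm z = z' at hz
  induction hz using Submodule.span_induction with
  | mem y hy =>
    obtain ⟨w, rfl⟩ := hy
    refine Submodule.subset_span ⟨w, ?_⟩
    exact congrArg root (τ.commutes (q w)).symm
  | zero => rw [map_zero]; exact Submodule.zero_mem _
  | add y y' _ _ hy hy' => rw [map_add]; exact Submodule.add_mem _ hy hy'
  | smul a y _ hy => rw [sqrtEquiv_smul]; exact Submodule.smul_mem _ _ hy

/-- The theorem extends $q$ first to $L$ and then to $L(p)$; for $L = F$ the first extension loses
no values. -/
theorem range_baseChange_baseChange_self {W : Type*} [AddCommGroup W] [Module F W]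
    (q : QuasilinearForm F W) : LinearMap.range (sqrtMap (baseChange E q)) ≤
      LinearMap.range (sqrtMap (baseChange E (baseChange F q))) := by
  rw [range_baseChange_eq_span, range_baseChange_eq_span, Submodule.span_le]
  rintro _ ⟨w, rfl⟩
  refine Submodule.subset_span ⟨1 ⊗ₜ w, ?_⟩
  dsimp only
  rw [sqrtMap_baseChange_tmul, one_smul]
  rfl

end Transport

/-! ### The field attached to the divisibility index. -/

section DivisibilityIndex

variable {F : Type*} [Field F] [CharP F 2] {V : Type*} [AddCommGroup V] [Module F V]

/-- If the index is positive and finite, its supremum is attained and the quasi-Pfister divisor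
gives the field. Otherwise `toNat` is 0, also for the value `⊤`, and $F$ itself serves. -/
theorem exists_field_of_divisibilityIndex (q : QuasilinearForm F V)
    (h0 : LinearMap.range (sqrtMap q) ≠ ⊥) :
    ∃ P : IntermediateField F (SqrtExt F),
      Module.finrank F P = 2 ^ (divisibilityIndex q).toNat ∧
      ∀ t ∈ P, ∀ z ∈ LinearMap.range (sqrtMap q), t * z ∈ LinearMap.range (sqrtMap q) := by
  rcases Nat.eq_zero_or_pos (divisibilityIndex q).toNat with hd | hd
  · refine ⟨⊥, by rw [hd, pow_zero, IntermediateField.finrank_bot], fun t ht z hz => ?_⟩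
    obtain ⟨a, rfl⟩ := IntermediateField.mem_bot.1 ht
    rw [← Algebra.smul_def]
    exact Submodule.smul_mem _ _ hz
  · set n := (divisibilityIndex q).toNat with hn
    have htop : divisibilityIndex q ≠ ⊤ := by
      intro htop
      rw [htop] at hn
      simp at hn
      omega
    have hcoe : divisibilityIndex q = n := (ENat.natCast_toNat htop).symm
    obtain ⟨s, hs, hns⟩ : ∃ s, IsDivisibleByQuasiPfister s (anisotropicPart q) ∧ n ≤ s := by
      by_contra! hcon
      have h1 : divisibilityIndex q ≤ ((n - 1 : ℕ) : ℕ∞) :=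
        iSup₂_le fun s hs => Nat.cast_le.2 (Nat.le_sub_one_of_lt (hcon s hs))
      rw [hcoe, Nat.cast_le] at h1
      omega
    have hsn : s ≤ n := by
      have h1 : (s : ℕ∞) ≤ divisibilityIndex q :=
        le_iSup₂ (f := fun (s : ℕ) (_ : s ∈ {s : ℕ | IsDivisibleByQuasiPfister s
          (anisotropicPart q)}) => (s : ℕ∞)) s hs
      rwa [hcoe, Nat.cast_le] at h1
    obtain rfl : n = s := le_antisymm hns hsn
    have h := exists_field_of_isDivisibleByQuasiPfister (anisotropic_anisotropicPart q)
      (by rwa [range_anisotropicPart]) hs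
    rwa [range_anisotropicPart] at h

end DivisibilityIndex

theorem isometric_baseChange_self {F V : Type*} [Field F] [CharP F 2] [AddCommGroup V]
    [Module F V] (p : QuasilinearForm F V) : Isometric p (baseChange F p) :=
  ⟨(TensorProduct.lid F V).symm, fun v => by
    rw [TensorProduct.lid_symm_apply, baseChange_tmul, one_pow, one_mul, Algebra.algebraMap_self,
      RingHom.id_apply]⟩

theorem Isometric.anisotropic {F V W : Type*} [Field F] [CharP F 2] [AddCommGroup V] [Module F V]
    [AddCommGroup W] [Module F W] {p : QuasilinearForm F V} {q : QuasilinearForm F W}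
    (h : Isometric p q) (hp : Anisotropic p) : Anisotropic q := by
  obtain ⟨e, he⟩ := h
  intro w hw
  rw [← e.apply_symm_apply w, he] at hw
  rw [← e.apply_symm_apply w, hp _ hw, map_zero]

end QuasilinearForm

/-! ### Proof of the proposition, with $L = F$. -/

theorem IsPurelyTranscendental.refl (F : Type*) [Field F] : IsPurelyTranscendental F F :=
  ⟨∅, algebraicIndependent_empty_type, Subsingleton.elim _ _⟩

open QuasilinearForm in
theorem proposition6p12 {F : Type u} [Field F] [CharP F 2]
    {V : Type v} [AddCommGroup V] [Module F V] [FiniteDimensional F V]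
    {W : Type w} [AddCommGroup W] [Module F W] [FiniteDimensional F W]
    (p : QuasilinearForm F V) (q : QuasilinearForm F W)
    (hp : Anisotropic p) (hq : Anisotropic q) (hdp : 2 ≤ dim p) (hdq : 2 ≤ dim q)
    (ε : ℕ) (hε : ε ∈ Set.Icc 1 (2 ^ firstDivisibilityIndex p))
    (hε' : isotropyIndex (baseChange (FunctionField p) q) + ε ≡ 0
      [MOD 2 ^ firstDivisibilityIndex p])
    (h : (dim q : ℤ) - 2 * isotropyIndex (baseChange (FunctionField p) q) < ε) :
    ∃ (L : Type u) (_ : Field L) (_ : CharP L 2) (_ : Algebra F L),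
      IsPurelyTranscendental F L ∧
      ∃ (m : ℕ) (r : QuasilinearForm (FunctionField (baseChange L p))
          (Fin m → FunctionField (baseChange L p))),
        IsSubform r
          (anisotropicPart (baseChange (FunctionField (baseChange L p)) (baseChange L q))) ∧
        dim r = isotropyIndex (baseChange (FunctionField p) q) ∧
        ((lndeg p - 1 : ℕ) : ℕ∞) ≤ divisibilityIndex r ∧
        IsDivisibleByQuasiPfister (lndeg p - 1) r := by
  have hnt : Nontrivial (Fin (Module.finrank F V)) := Fin.nontrivial_iff_two_le.2 hdp
  obtain ⟨i, j, hij⟩ := exists_pair_ne (Fin (Module.finrank F V))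
  have hmodel := isQuadricFunctionField p hp hdp hij
  have hv₀ : Module.finBasis F V i ≠ 0 := (Module.finBasis F V).ne_zero i
  have hB : LinearMap.range (sqrtMap (baseChange (FunctionField p) p)) ≠ ⊥ := by
    intro hbot
    have h1 : sqrtMap (baseChange (FunctionField p) p) (1 ⊗ₜ Module.finBasis F V i) ∈
        LinearMap.range (sqrtMap (baseChange (FunctionField p) p)) := ⟨_, rfl⟩
    rw [hbot, Submodule.mem_bot, sqrtMap_baseChange_tmul, one_smul, map_eq_zero, sqrtMap_apply,
      map_eq_zero_iff _ SqrtExt.root.injective] at h1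
    exact hv₀ (hp _ h1)
  obtain ⟨P, hP, hPB⟩ := exists_field_of_divisibilityIndex (firstKernel p)
    (by rwa [firstKernel, range_anisotropicPart])
  rw [firstKernel, range_anisotropicPart] at hPB
  obtain ⟨R, T, hR, hRdim, hT, hTR⟩ := hmodel.exists_stable_submodule hp (sqrtMap_mem_span p i j)
    hv₀ q hq P hP hPB hε.2 ((Nat.modEq_zero_iff_dvd).1 hε') (by omega)
  -- The field $F(p_F)$ is built from $F \otimes V$, so it is only isomorphic to $F(p)$; the
  -- subspaces found over $F(p)$ are transported along `τ`.
  have hiso := isometric_baseChange_self p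
  have hdim : dim (baseChange F p) = dim p := Module.finrank_baseChange
  obtain ⟨τ⟩ := hiso.nonempty_functionField_equiv hp (hiso.anisotropic hp) hdp (hdim ▸ hdp)
  have hR' : mapSubmodule τ R ≤ LinearMap.range (sqrtMap
      (baseChange (FunctionField (baseChange F p)) (baseChange F q))) := by
    refine le_trans (fun z hz => hR hz) ((mapSubmodule_range_le τ q).trans
      (range_baseChange_baseChange_self q))
  have hfin : FiniteDimensional (FunctionField (baseChange F p)) (mapSubmodule τ R) :=
    Submodule.finiteDimensional_of_le hR'
  obtain ⟨r, hr, hrange⟩ := exists_form_of_submodule (mapSubmodule τ R)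
  have hstab : ∀ t ∈ mapSubmodule τ T, ∀ z ∈ LinearMap.range (sqrtMap r),
      t * z ∈ LinearMap.range (sqrtMap r) := by
    rw [hrange]
    intro t ht z hz
    rw [mem_mapSubmodule] at ht hz ⊢
    rw [map_mul]
    exact hTR _ ht _ hz
  have hT' : 2 ^ (lndeg p - 1) ≤
      Module.finrank (FunctionField (baseChange F p)) (mapSubmodule τ T) := by
    rwa [finrank_mapSubmodule]
  refine ⟨F, inferInstance, inferInstance, Algebra.id F, IsPurelyTranscendental.refl F, _, r,
    ?_, ?_, ?_, ?_⟩
  · refine isSubform_of_range_le hr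
      ((sqrtMap_injective_iff _).2 (anisotropic_anisotropicPart _)) ?_
    rw [hrange, range_anisotropicPart]
    exact hR'
  · rw [dim, Module.finrank_fin_fun, finrank_mapSubmodule, hRdim]
  -- The divisibility index refers to the anisotropic part of $r$, which has the same image as $r$
  -- and hence the same stability.
  · refine le_iSup₂ (f := fun (s : ℕ) (_ : s ∈ {s : ℕ | IsDivisibleByQuasiPfister s
      (anisotropicPart r)}) => (s : ℕ∞)) (lndeg p - 1) ?_
    refine isDivisibleByQuasiPfister_of_stable
      ((sqrtMap_injective_iff _).2 (anisotropic_anisotropicPart r)) (mapSubmodule τ T) ?_ hT'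
    rw [range_anisotropicPart]
    exact hstab
  · exact isDivisibleByQuasiPfister_of_stable hr (mapSubmodule τ T) hstab hT'
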